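/- Let $p$ be a prime, $k$ a field of characteristic $p$, and $G$ a finite group of order $p^n$ with $n\ge 1$. A $k$-$G$-algebra is a commutative $k$-algebra with an action of $G$ by $k$-algebra automorphisms; $A^G$ is its ring of invariants. It is trace-surjective if $\{\sum_{g\in G} g(a) : a\in A\}=A^G$. Let $\mathfrak{Ts}$ be the category of finitely generated trace-surjective $k$-$G$-algebras with $G$-equivariant $k$-algebra homomorphisms. Write $R^{[m]}$ for the polynomial ring in $m$ variables over $R$, and $A^{\otimes\ell}$ for the $\ell$-fold tensor power over $k$ with diagonal $G$-action. An object $\Gamma\in\mathfrak{Ts}$ is *s-projective* if for every surjective morphism $A\to B$ in $\mathfrak{Ts}$ every morphism $\Gamma\to B$ lifts to a morphism $\Gamma\to A$; it is an *s-generator* if every $R\in\mathfrak{Ts}$ is the image of a surjective morphism $\Gamma^{\otimes\ell}\to R$ for some $\ell\ge1$; it is a *generator* if for any two distinct morphisms $f_1,f_2:A\to B$ in $\mathfrak{Ts}$ there is a morphism $h:\Gamma\to A$ with $f_1h\ne f_2h$. A $k$-$G$-algebra $\Gamma=k[T_1,\dots,T_d]\cong k^{[d]}$ is *triangular* if, for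 suitable polynomial generators $T_i$, $g(T_i)-T_i\in k[T_1,\dots,T_{i-1}]$ for all $g\in G$ and all $i$. A $k$-algebra $R$ is *stably polynomial* if $R^{[m]}\cong k^{[N]}$ as $k$-algebras for some $m,N\ge 0$. Let $D_k=k[X_g : g\in G]/\bigl(\sum_{g}X_g-1\bigr)$, with $G$ permuting the $X_g$ regularly. Let $U$ denote any $G$-stable subalgebra of $D_k$ that lies in $\mathfrak{Ts}$, is isomorphic to $k^{[n]}$ with triangular $G$-action, satisfies $D_k=U\oplus I$ for some $G$-stable ideal $I$ of $D_k$, and has $U^G\cong k^{[n]}$. **Theorem.** Such a subalgebra $U$ exists, and $D_k\in\mathfrak{Ts}$ is isomorphic to $k^{[|G|-1]}$ with triangular $G$-action. Let $\Gamma\in\mathfrak{Ts}$ be isomorphic to $k^{[d]}$ with triangular $G$-action (for example $\Gamma=D_k$ or $\Gamma=U$). Then: 1. $\Gamma$ is s-projective, an s-generator and a generator in $\mathfrak{Ts}$. 2. For every $A\in\mathfrak{Ts}$ there is a $G$-equivariant isomorphism of $A$-algebras $A[T_1,\dots,T_d]\cong A\otimes_k\Gamma$, where $G$ acts on the left side through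 the coefficients, so that the variables $T_i$ are invariant; it restricts to an isomorphism $A^G[T_1,\dots,T_d]\cong(A\otimes_k\Gamma)^G$. 3. For every $\ell\ge1$ there are $N\ge 0$ and a $G$-equivariant isomorphism of $k$-algebras $\Gamma^{\otimes\ell}\cong\Gamma\otimes_k k[s_1,\dots,s_N]$, where $s_1,\dots,s_N$ are independent variables fixed by $G$. 4. For every $\ell\ge1$ the ring $(\Gamma^{\otimes\ell})^G$ is stably polynomial. 5. If $\Gamma=D_k$ or $\Gamma=U$, then $(\Gamma^{\otimes\ell})^G$ is a polynomial ring over $k$ in finitely many variables for every $\ell\ge1$. -/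

import Mathlib

open scoped TensorProduct

universe u v w t

noncomputable section

namespace GAlg

section Basic

variable {k G A B : Type*} [CommRing k] [Group G]
  [CommRing A] [Algebra k A] [CommRing B] [Algebra k B]

/- A `k`-`G`-algebra is a commutative `k`-algebra `A` with a homomorphism `ρ : G →* (A ≃ₐ[k] A)`;
the right action `(a)g` is the left action `ρ g⁻¹ a`. -/

/-- The ring of invariants `A^G`. -/
def invariants (ρ : G →* (A ≃ₐ[k] A)) : Subalgebra k A where
  carrier := {a | ∀ g, ρ g a = a}
  mul_mem' := by
    intro a b ha hb g
    rw [map_mul, ha g, hb g]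
  add_mem' := by
    intro a b ha hb g
    rw [map_add, ha g, hb g]
  algebraMap_mem' := by
    intro r g
    exact (ρ g).commutes r

/-- The trace (transfer) map `a ↦ ∑_g g(a)`. -/
def trace [Fintype G] (ρ : G →* (A ≃ₐ[k] A)) (a : A) : A := ∑ g, ρ g a

/-- `A` is trace-surjective: `tr(A) = A^G`. -/
def IsTraceSurjective [Fintype G] (ρ : G →* (A ≃ₐ[k] A)) : Prop :=
  Set.range (trace ρ) = (invariants ρ : Set A)

/-- The objects of the category `𝔗𝔰`: finitely generated trace-surjective `k`-`G`-algebras. -/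
def IsTs [Fintype G] (ρ : G →* (A ≃ₐ[k] A)) : Prop :=
  Algebra.FiniteType k A ∧ IsTraceSurjective ρ

/-- Equivariance of a `k`-algebra homomorphism; the equivariant ones are the morphisms of `𝔗𝔰`. -/
def IsEquivariant (ρ : G →* (A ≃ₐ[k] A)) (σ : G →* (B ≃ₐ[k] B)) (f : A →ₐ[k] B) : Prop :=
  ∀ g a, f (ρ g a) = σ g (f a)

/-- The diagonal action of `G` on `A ⊗ B`. -/
def tensorAction (ρ : G →* (A ≃ₐ[k] A)) (σ : G →* (B ≃ₐ[k] B)) :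
    G →* ((A ⊗[k] B) ≃ₐ[k] (A ⊗[k] B)) where
  toFun g := Algebra.TensorProduct.congr (ρ g) (σ g)
  map_one' := by
    ext x
    induction x using TensorProduct.induction_on with
    | zero => simp
    | tmul a b => simp
    | add x y hx hy => rw [map_add, hx, hy, map_add]
  map_mul' g h := by
    ext x
    induction x using TensorProduct.induction_on with
    | zero => simp
    | tmul a b => simp
    | add x y hx hy => rw [map_add, hx, hy, map_add]

/-- The underlying endomorphism of the diagonal action on a tensor power. -/
def tensorPowerHom (ℓ : ℕ) (f : A ≃ₐ[k] A) :
    (⨂[k] _ : Fin ℓ, A) →ₐ[k] (⨂[k] _ : Fin ℓ, A) :=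
  AlgHom.ofLinearMap (PiTensorProduct.map fun _ => f.toLinearMap)
    (by
      rw [PiTensorProduct.one_def, PiTensorProduct.map_tprod]
      congr 1
      ext i
      simp)
    (by
      intro x y
      induction x using PiTensorProduct.induction_on with
      | add x₁ x₂ h₁ h₂ => rw [add_mul, map_add, map_add, h₁, h₂, add_mul]
      | smul_tprod r a =>
        induction y using PiTensorProduct.induction_on with
        | add y₁ y₂ h₁ h₂ => rw [mul_add, map_add, map_add, h₁, h₂, mul_add]
        | smul_tprod s b =>
          rw [PiTensorProduct.smul_tprod_mul_smul_tprod]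
          simp only [map_smul, PiTensorProduct.map_tprod]
          rw [PiTensorProduct.smul_tprod_mul_smul_tprod]
          congr 2
          ext i
          simp)

theorem tensorPowerHom_tprod (ℓ : ℕ) (f : A ≃ₐ[k] A) (a : Fin ℓ → A) :
    tensorPowerHom ℓ f (PiTensorProduct.tprod k a) = PiTensorProduct.tprod k fun i => f (a i) :=
  PiTensorProduct.map_tprod _ _

theorem tensorPowerHom_comp (ℓ : ℕ) (f g : A ≃ₐ[k] A) (x : ⨂[k] _ : Fin ℓ, A) :
    tensorPowerHom ℓ f (tensorPowerHom ℓ g x) = tensorPowerHom ℓ (f * g) x := by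
  induction x using PiTensorProduct.induction_on with
  | add x y hx hy => simp only [map_add, hx, hy]
  | smul_tprod r a => simp only [map_smul, tensorPowerHom_tprod, AlgEquiv.mul_apply]

theorem tensorPowerHom_one (ℓ : ℕ) (x : ⨂[k] _ : Fin ℓ, A) :
    tensorPowerHom ℓ (1 : A ≃ₐ[k] A) x = x := by
  induction x using PiTensorProduct.induction_on with
  | add x y hx hy => simp only [map_add, hx, hy]
  | smul_tprod r a => simp only [map_smul, tensorPowerHom_tprod, AlgEquiv.one_apply]

/-- The diagonal action of `G` on the `ℓ`-fold tensor power `A^{⊗ℓ}` over `k`. -/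
def tensorPowerAction (ℓ : ℕ) (ρ : G →* (A ≃ₐ[k] A)) :
    G →* ((⨂[k] _ : Fin ℓ, A) ≃ₐ[k] (⨂[k] _ : Fin ℓ, A)) where
  toFun g := AlgEquiv.ofAlgHom (tensorPowerHom ℓ (ρ g)) (tensorPowerHom ℓ (ρ g⁻¹))
    (by
      refine AlgHom.ext fun x => ?_
      rw [AlgHom.comp_apply, tensorPowerHom_comp, ← map_mul, mul_inv_cancel, map_one,
        tensorPowerHom_one, AlgHom.id_apply])
    (by
      refine AlgHom.ext fun x => ?_
      rw [AlgHom.comp_apply, tensorPowerHom_comp, ← map_mul, inv_mul_cancel, map_one,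
        tensorPowerHom_one, AlgHom.id_apply])
  map_one' := by
    ext1 x
    change tensorPowerHom ℓ (ρ 1) x = x
    rw [map_one, tensorPowerHom_one]
  map_mul' g h := by
    ext1 x
    change tensorPowerHom ℓ (ρ (g * h)) x = tensorPowerHom ℓ (ρ g) (tensorPowerHom ℓ (ρ h) x)
    rw [map_mul, tensorPowerHom_comp]

/-- The restriction of the action to a `G`-stable subalgebra. -/
def restrictAction (ρ : G →* (A ≃ₐ[k] A)) (U : Subalgebra k A)
    (hU : ∀ g, ∀ u ∈ U, ρ g u ∈ U) : G →* (U ≃ₐ[k] U) where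
  toFun g := AlgEquiv.ofAlgHom
    (((ρ g).toAlgHom.comp U.val).codRestrict U fun u => hU g u u.2)
    (((ρ g⁻¹).toAlgHom.comp U.val).codRestrict U fun u => hU g⁻¹ u u.2)
    (by
      ext u
      change ρ g (ρ g⁻¹ u) = u
      rw [← AlgEquiv.mul_apply, ← map_mul, mul_inv_cancel, map_one, AlgEquiv.one_apply])
    (by
      ext u
      change ρ g⁻¹ (ρ g u) = u
      rw [← AlgEquiv.mul_apply, ← map_mul, inv_mul_cancel, map_one, AlgEquiv.one_apply])
  map_one' := by
    ext u
    change ρ 1 (u : A) = u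
    rw [map_one, AlgEquiv.one_apply]
  map_mul' g h := by
    ext u
    change ρ (g * h) (u : A) = ρ g (ρ h u)
    rw [map_mul, AlgEquiv.mul_apply]

/-- `A ≅ k^{[d]} = k[T_1, …, T_d]` with triangular `G`-action: for suitable polynomial generators
`T_i` every `g ∈ G` maps `T_i` into `T_i + k[T_1, …, T_{i-1}]`. -/
def IsTriangularPolynomial (d : ℕ) (ρ : G →* (A ≃ₐ[k] A)) : Prop :=
  ∃ e : MvPolynomial (Fin d) k ≃ₐ[k] A, ∀ g i,
    ρ g (e (MvPolynomial.X i)) - e (MvPolynomial.X i) ∈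
      Algebra.adjoin k ((fun j => e (MvPolynomial.X j)) '' {j | j < i})

/-- `R` is a retract of `A`: `A = R ⊕ I` with a `G`-stable ideal `I`. -/
def IsStableRetract (ρ : G →* (A ≃ₐ[k] A)) (R : Subalgebra k A) : Prop :=
  ∃ I : Ideal A, (∀ g, ∀ a ∈ I, ρ g a ∈ I) ∧
    IsCompl (Subalgebra.toSubmodule R) (I.restrictScalars k)

end Basic

section PolynomialRings

variable (k R : Type*) [CommRing k] [CommRing R] [Algebra k R]

/-- `R` is a polynomial ring over `k` in finitely many variables. -/
def IsPolynomialRing : Prop :=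
  ∃ N : ℕ, Nonempty (R ≃ₐ[k] MvPolynomial (Fin N) k)

/-- `R` is stably polynomial: `R^{[m]} ≅ k^{[N]}` for some `m` and `N`. -/
def IsStablyPolynomial : Prop :=
  ∃ m N : ℕ, Nonempty (MvPolynomial (Fin m) R ≃ₐ[k] MvPolynomial (Fin N) k)

end PolynomialRings

section Category

variable {k G Γ : Type*} [CommRing k] [Group G] [Fintype G] [CommRing Γ] [Algebra k Γ]

/-- `Γ` is s-projective: `𝔗𝔰(Γ, ·)` turns surjective morphisms into surjective maps. -/
def IsSProjective (ρ : G →* (Γ ≃ₐ[k] Γ)) : Prop :=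
  ∀ (A B : Type t) [CommRing A] [Algebra k A] [CommRing B] [Algebra k B]
    (α : G →* (A ≃ₐ[k] A)) (β : G →* (B ≃ₐ[k] B)), IsTs α → IsTs β →
    ∀ f : A →ₐ[k] B, IsEquivariant α β f → Function.Surjective f →
    ∀ h : Γ →ₐ[k] B, IsEquivariant ρ β h →
    ∃ h' : Γ →ₐ[k] A, IsEquivariant ρ α h' ∧ f.comp h' = h

/-- `Γ` is an s-generator: every object is the image of some `Γ^{⊗ℓ}`, `ℓ ≥ 1`, under a surjective
morphism. -/
def IsSGenerator (ρ : G →* (Γ ≃ₐ[k] Γ)) : Prop :=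
  ∀ (R : Type t) [CommRing R] [Algebra k R] (σ : G →* (R ≃ₐ[k] R)), IsTs σ →
    ∃ ℓ : ℕ, 1 ≤ ℓ ∧ ∃ Ψ : (⨂[k] _ : Fin ℓ, Γ) →ₐ[k] R,
      IsEquivariant (tensorPowerAction ℓ ρ) σ Ψ ∧ Function.Surjective Ψ

/-- `Γ` is a (categorical) generator: `𝔗𝔰(Γ, ·)` is injective on morphisms. -/
def IsGenerator (ρ : G →* (Γ ≃ₐ[k] Γ)) : Prop :=
  ∀ (A B : Type t) [CommRing A] [Algebra k A] [CommRing B] [Algebra k B]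
    (α : G →* (A ≃ₐ[k] A)) (β : G →* (B ≃ₐ[k] B)), IsTs α → IsTs β →
    ∀ f₁ f₂ : A →ₐ[k] B, IsEquivariant α β f₁ → IsEquivariant α β f₂ → f₁ ≠ f₂ →
    ∃ h : Γ →ₐ[k] A, IsEquivariant ρ α h ∧ f₁.comp h ≠ f₂.comp h

end Category

section Dehomogenization

variable (k G : Type*) [CommRing k] [Group G]

/-- The action of `G` on `Sym(V_reg^*) = k[X_g | g ∈ G]` by `h(X_g) = X_{hg}`. -/
def symRegAction : G →* (MvPolynomial G k ≃ₐ[k] MvPolynomial G k) where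
  toFun h := MvPolynomial.renameEquiv k (Equiv.mulLeft h)
  map_one' := by
    refine AlgEquiv.ext fun x => ?_
    induction x using MvPolynomial.induction_on with
    | C a => simp
    | add p q hp hq => rw [map_add, hp, hq, map_add]
    | mul_X p i hp => rw [map_mul, hp, map_mul]; simp
  map_mul' h h' := by
    refine AlgEquiv.ext fun x => ?_
    induction x using MvPolynomial.induction_on with
    | C a => simp
    | add p q hp hq => rw [map_add, hp, hq, map_add]
    | mul_X p i hp => rw [map_mul, hp, map_mul]; simp [mul_assoc]

variable [Fintype G]

/-- The ideal generated by `(∑_g X_g) - 1`. -/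
def dehomIdeal : Ideal (MvPolynomial G k) :=
  Ideal.span {(∑ g, MvPolynomial.X g) - 1}

theorem dehomIdeal_map (h : G) :
    dehomIdeal k G = (dehomIdeal k G).map (symRegAction k G h : MvPolynomial G k →+* _) := by
  have key : symRegAction k G h ((∑ g, MvPolynomial.X g) - 1) = (∑ g, MvPolynomial.X g) - 1 := by
    rw [map_sub, map_one, map_sum]
    congr 1
    refine Fintype.sum_equiv (Equiv.mulLeft h) _ _ fun g => ?_
    simp [symRegAction]
  rw [dehomIdeal, Ideal.map_span, Set.image_singleton]
  exact congrArg (fun x => Ideal.span {x}) key.symm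

/-- `D_k = Sym(V_reg^*) / (∑_g X_g - 1)`, the dehomogenization of the symmetric algebra. -/
abbrev Dk := MvPolynomial G k ⧸ dehomIdeal k G

/-- The action of `G` on `D_k`, induced by `h(X_g) = X_{hg}`. -/
def DkAction : G →* (Dk k G ≃ₐ[k] Dk k G) where
  toFun h := Ideal.quotientEquivAlg _ _ (symRegAction k G h) (dehomIdeal_map k G h)
  map_one' := by
    ext x
    obtain ⟨x, rfl⟩ := Ideal.Quotient.mk_surjective x
    rw [Ideal.quotientEquivAlg_mk, map_one]
    rfl
  map_mul' h h' := by
    ext x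
    obtain ⟨x, rfl⟩ := Ideal.Quotient.mk_surjective x
    rw [AlgEquiv.mul_apply, Ideal.quotientEquivAlg_mk, Ideal.quotientEquivAlg_mk,
      Ideal.quotientEquivAlg_mk, map_mul, AlgEquiv.mul_apply]

end Dehomogenization

/-- The algebras `U ≤ D_k(G)`, where `|G| = p^n`: `G`-stable subalgebras of `D_k` that are
trace-surjective, isomorphic to `k^{[n]}` with triangular action, retracts of `D_k` with `G`-stable
complementary ideal, and that have polynomial invariant ring `U^G ≅ k^{[n]}`. -/
structure IsU (k G : Type*) [CommRing k] [Group G] [Fintype G] (n : ℕ)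
    (U : Subalgebra k (Dk k G)) : Prop where
  stable : ∀ g, ∀ u ∈ U, DkAction k G g u ∈ U
  ts : IsTs (restrictAction (DkAction k G) U stable)
  triangular : IsTriangularPolynomial n (restrictAction (DkAction k G) U stable)
  retract : IsStableRetract (DkAction k G) U
  invariants : Nonempty
    (invariants (restrictAction (DkAction k G) U stable) ≃ₐ[k] MvPolynomial (Fin n) k)

end GAlg

end

/-! Everything rests on points, elements c of trace one; an algebra is trace-surjective exactly when
it has one. Let A have a point c and let B = A[T_1,…,T_m] carry a triangular action over A. Then
tr(c T_i) = T_i + ∑_g g(c)(g T_i − T_i) differs from T_i by a polynomial in the earlier variables,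
so these traces are invariant and again free generators of B over A. Hence B^G is a polynomial ring
over A^G (`exists_invariant_variables`, `exists_invariants_equiv`). With B = A ⊗ Γ this is assertion
2, and applying it to Γ ⊗ Γ repeatedly gives assertion 3. Moreover every d-tuple of invariants of A
now defines a morphism Γ → A, and invariants lift along surjections by means of tr(c ·); this is
s-projectivity.

In characteristic p a point makes a p-group act in a Galois fashion: some ∑ a_i ⊗ b_i satisfies ∑
a_i g(b_i) = δ_{g,1}. Then r = ∑ a_i tr(b_i r), so a morphism that hits all invariants is surjective
(`surjective_of_invariants_le_range`). The images of the morphisms Γ → A contain a point and,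
through the first variable, generate all invariants. They therefore generate A
(`adjoin_images_eq_top`), which gives both generator properties.

The invariants of Γ^{⊗ℓ} are polynomial over Γ^G, and Γ^G is compared with D_k^G inside (Γ ⊗ D_k)^G.
What remains is that D_k^G is polynomial and that U exists. Both go by induction along a central
subgroup H of order p. A G/H-algebra A with a point c extends to A[X] with g X = X + f(g), where the
cocycle f restricts to H ≅ ℤ/p; the extension has the point −c X^{p−1}, and its invariants are the
polynomial ring over those of A in a twisted Artin–Schreier polynomial X^p − X + b. Iterated from k,
this yields an algebra in n variables generated by the orbit of a point; D_k maps onto it, the map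
splits by s-projectivity, and U is the image of the splitting. Applied to D_k(G/H), it yields an
algebra over which D_k(G) is a triangular extension. -/

noncomputable section

namespace GAlg

/-! ### Points of trace one and equivariant maps -/

section Points

variable {k G A B : Type*} [CommRing k] [Group G] [CommRing A] [Algebra k A]
  [CommRing B] [Algebra k B]

theorem action_mul_apply (ρ : G →* (A ≃ₐ[k] A)) (g h : G) (a : A) :
    ρ (g * h) a = ρ g (ρ h a) := by
  rw [map_mul, AlgEquiv.mul_apply]

theorem action_one_apply (ρ : G →* (A ≃ₐ[k] A)) (a : A) : ρ 1 a = a := by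
  rw [map_one, AlgEquiv.one_apply]

variable [Fintype G]

theorem trace_mem_invariants (ρ : G →* (A ≃ₐ[k] A)) (a : A) : trace ρ a ∈ invariants ρ := by
  intro g
  simp only [trace, map_sum, ← action_mul_apply]
  exact Fintype.sum_equiv (Equiv.mulLeft g) _ _ fun h => rfl

theorem trace_mul_of_mem_invariants (ρ : G →* (A ≃ₐ[k] A)) {a : A} (ha : a ∈ invariants ρ)
    (b : A) : trace ρ (b * a) = trace ρ b * a := by
  simp only [trace, map_mul, Finset.sum_mul]
  exact Finset.sum_congr rfl fun g _ => by rw [ha g]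

/-- The trace is linear over the invariants, so tr(c a) = a for invariant a once tr c = 1. -/
theorem isTraceSurjective_iff (ρ : G →* (A ≃ₐ[k] A)) :
    IsTraceSurjective ρ ↔ ∃ c, trace ρ c = 1 := by
  constructor
  · intro h
    have h1 : (1 : A) ∈ (invariants ρ : Set A) := (invariants ρ).one_mem
    rw [← h] at h1
    exact h1
  · rintro ⟨c, hc⟩
    refine Set.Subset.antisymm ?_ fun a ha => ⟨c * a, ?_⟩
    · rintro _ ⟨a, rfl⟩
      exact trace_mem_invariants ρ a
    · rw [trace_mul_of_mem_invariants ρ ha, hc, one_mul]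

theorem IsTs.exists_point {ρ : G →* (A ≃ₐ[k] A)} (h : IsTs ρ) : ∃ c, trace ρ c = 1 :=
  (isTraceSurjective_iff ρ).1 h.2

theorem IsEquivariant.map_trace {ρ : G →* (A ≃ₐ[k] A)} {σ : G →* (B ≃ₐ[k] B)} {f : A →ₐ[k] B}
    (hf : IsEquivariant ρ σ f) (a : A) : f (trace ρ a) = trace σ (f a) := by
  simp only [trace, map_sum]
  exact Finset.sum_congr rfl fun g _ => hf g a

omit [Fintype G] in
theorem IsEquivariant.comp {C : Type*} [CommRing C] [Algebra k C] {ρ : G →* (A ≃ₐ[k] A)}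
    {σ : G →* (B ≃ₐ[k] B)} {τ : G →* (C ≃ₐ[k] C)} {f : B →ₐ[k] C} {f' : A →ₐ[k] B}
    (hf : IsEquivariant σ τ f) (hf' : IsEquivariant ρ σ f') : IsEquivariant ρ τ (f.comp f') := by
  intro g a
  rw [AlgHom.comp_apply, hf', hf, AlgHom.comp_apply]

omit [Fintype G] in
theorem IsEquivariant.symm {ρ : G →* (A ≃ₐ[k] A)} {σ : G →* (B ≃ₐ[k] B)} {e : A ≃ₐ[k] B}
    (he : IsEquivariant ρ σ (e : A →ₐ[k] B)) : IsEquivariant σ ρ (e.symm : B →ₐ[k] A) := by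
  intro g b
  apply e.injective
  have := he g (e.symm b)
  simp only [AlgEquiv.coe_toAlgHom] at this ⊢
  rw [this, e.apply_symm_apply, e.apply_symm_apply]

omit [Fintype G] in
/-- The invariant rings of isomorphic `G`-algebras are isomorphic. -/
theorem IsEquivariant.nonempty_invariants_equiv {ρ : G →* (A ≃ₐ[k] A)} {σ : G →* (B ≃ₐ[k] B)}
    {e : A ≃ₐ[k] B} (he : IsEquivariant ρ σ (e : A →ₐ[k] B)) :
    Nonempty (invariants ρ ≃ₐ[k] invariants σ) := by
  have h1 : ∀ a : invariants ρ, (e : A →ₐ[k] B).comp (invariants ρ).val a ∈ invariants σ := by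
    intro a g
    change σ g (e a) = e a
    have := he g a
    rw [a.2 g] at this
    exact this.symm
  have h2 : ∀ b : invariants σ,
      (e.symm : B →ₐ[k] A).comp (invariants σ).val b ∈ invariants ρ := by
    intro b g
    change ρ g (e.symm b) = e.symm b
    have := he.symm g b
    rw [b.2 g] at this
    exact this.symm
  refine ⟨AlgEquiv.ofAlgHom (AlgHom.codRestrict _ _ h1) (AlgHom.codRestrict _ _ h2) ?_ ?_⟩
  · ext b
    exact e.apply_symm_apply b
  · ext a
    exact e.symm_apply_apply a

end Points

/-! ### The Hopfian property of noetherian rings -/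

section Hopfian

/-- A surjective ring homomorphism between isomorphic noetherian rings is injective. -/
theorem injective_of_surjective_of_ringEquiv {R S : Type*} [CommRing R] [CommRing S]
    [IsNoetherianRing R] (f : R →+* S) (hf : Function.Surjective f) (e : S ≃+* R) :
    Function.Injective f := by
  let φ : R →+* R := (e : S →+* R).comp f
  have hφ : Function.Surjective φ := e.surjective.comp hf
  suffices h : Function.Injective φ from fun x y hxy => h (congrArg e hxy)
  let K : ℕ →o Ideal R :=
    { toFun := fun n => RingHom.ker (φ ^ n)
      monotone' := by
        refine monotone_nat_of_le_succ fun n x hx => ?_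
        rw [RingHom.mem_ker] at hx ⊢
        rw [pow_succ', RingHom.mul_def, RingHom.comp_apply, hx, map_zero] }
  obtain ⟨n, hn⟩ := monotone_stabilizes_iff_noetherian.2 (inferInstance : IsNoetherian R R) K
  rw [injective_iff_map_eq_zero]
  intro x hx
  have hs : ∀ m : ℕ, Function.Surjective (φ ^ m) := by
    intro m
    induction m with
    | zero => exact Function.surjective_id
    | succ m ih =>
      rw [pow_succ', RingHom.mul_def]
      exact hφ.comp ih
  -- The kernels of the powers of φ are stable from n on. Writing x = φ^n y, the equation φ x = 0
  -- puts y into ker φ^{n+1} = ker φ^n, so x = 0.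
  obtain ⟨y, rfl⟩ := hs n x
  have hy : y ∈ K (n + 1) := by
    change (φ ^ (n + 1)) y = 0
    rw [pow_succ', RingHom.mul_def, RingHom.comp_apply, hx]
  rw [← hn (n + 1) n.le_succ] at hy
  exact hy

end Hopfian

/-! ### Unitriangular changes of variables -/

section Unitriangular

variable {A B : Type*} [CommRing A] [CommRing B] [Algebra A B] {m : ℕ}

/-- Each x_j is y_j minus a polynomial in earlier x's, which by induction is a polynomial in earlier
y's. -/
theorem adjoin_image_lt_le_of_sub_mem (x y : Fin m → B)
    (h : ∀ i, y i - x i ∈ Algebra.adjoin A (x '' {j | j < i})) (i : Fin m) :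
    Algebra.adjoin A (x '' {j | j < i}) ≤ Algebra.adjoin A (y '' {j | j < i}) := by
  induction i using WellFoundedLT.induction with
  | ind i ih =>
    refine Algebra.adjoin_le ?_
    rintro _ ⟨j, hj, rfl⟩
    have h1 := ih j hj (h j)
    have h2 : Algebra.adjoin A (y '' {l | l < j}) ≤ Algebra.adjoin A (y '' {l | l < i}) :=
      Algebra.adjoin_mono (Set.image_mono fun l (hl : l < j) => show l < i from lt_trans hl hj)
    have h3 : y j ∈ Algebra.adjoin A (y '' {l | l < i}) :=
      Algebra.subset_adjoin ⟨j, hj, rfl⟩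
    have := Subalgebra.sub_mem _ h3 (h2 h1)
    rwa [sub_sub_cancel] at this

/-- Over a noetherian ring, a unitriangular substitution in a polynomial ring is an
automorphism. -/
theorem exists_equiv_of_unitriangular [IsNoetherianRing A]
    (e : MvPolynomial (Fin m) A ≃ₐ[A] B) (y : Fin m → B)
    (h : ∀ i, y i - e (MvPolynomial.X i) ∈
      Algebra.adjoin A ((fun j => e (MvPolynomial.X j)) '' {j | j < i})) :
    ∃ φ : MvPolynomial (Fin m) A ≃ₐ[A] B, ∀ i, φ (MvPolynomial.X i) = y i := by
  let f : MvPolynomial (Fin m) A →ₐ[A] B := MvPolynomial.aeval y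
  have hr : ∀ i, e (MvPolynomial.X i) ∈ f.range := by
    intro i
    have h1 := adjoin_image_lt_le_of_sub_mem (fun j => e (MvPolynomial.X j)) y h i (h i)
    have h2 : Algebra.adjoin A (y '' {j | j < i}) ≤ f.range := by
      refine Algebra.adjoin_le ?_
      rintro _ ⟨j, -, rfl⟩
      exact ⟨MvPolynomial.X j, MvPolynomial.aeval_X _ _⟩
    have h3 : y i ∈ f.range := ⟨MvPolynomial.X i, MvPolynomial.aeval_X _ _⟩
    have := Subalgebra.sub_mem _ h3 (h2 h1)
    rwa [sub_sub_cancel] at this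
  have hs : Function.Surjective f := by
    rw [← AlgHom.range_eq_top, eq_top_iff]
    have : (⊤ : Subalgebra A B) = (e : MvPolynomial (Fin m) A →ₐ[A] B).range :=
      (AlgHom.range_eq_top _).2 e.surjective |>.symm
    rw [this, ← Algebra.map_top, ← MvPolynomial.adjoin_range_X, AlgHom.map_adjoin]
    refine Algebra.adjoin_le ?_
    rintro _ ⟨_, ⟨i, rfl⟩, rfl⟩
    exact hr i
  -- No inverse substitution is written down: a surjection between isomorphic noetherian rings is
  -- injective.
  have hi : Function.Injective f :=
    injective_of_surjective_of_ringEquiv (f : MvPolynomial (Fin m) A →+* B) hs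
      (e.symm : B ≃+* MvPolynomial (Fin m) A)
  exact ⟨AlgEquiv.ofBijective f ⟨hi, hs⟩, fun i => MvPolynomial.aeval_X _ _⟩

end Unitriangular

/-! ### Invariant variables of a triangular extension -/

section TriangularExtension

variable {k G A B : Type*} [CommRing k] [Group G] [Fintype G] [CommRing A] [Algebra k A]
  [CommRing B] [Algebra k B] [Algebra A B] {m : ℕ}

/-- A triangular extension of a noetherian algebra with a point of trace one is generated by
independent invariant variables. -/
theorem exists_invariant_variables [IsNoetherianRing A]
    (α : G →* (A ≃ₐ[k] A)) (β : G →* (B ≃ₐ[k] B))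
    (hαβ : ∀ g a, β g (algebraMap A B a) = algebraMap A B (α g a))
    (c : A) (hc : trace α c = 1) (e : MvPolynomial (Fin m) A ≃ₐ[A] B)
    (h : ∀ g i, β g (e (MvPolynomial.X i)) - e (MvPolynomial.X i) ∈
      Algebra.adjoin A ((fun j => e (MvPolynomial.X j)) '' {j | j < i})) :
    ∃ φ : MvPolynomial (Fin m) A ≃ₐ[A] B, (∀ i, φ (MvPolynomial.X i) ∈ invariants β) ∧
      ∀ i, φ (MvPolynomial.X i) - e (MvPolynomial.X i) ∈
        Algebra.adjoin A ((fun j => e (MvPolynomial.X j)) '' {j | j < i}) := by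
  -- Because the conjugates of c sum to 1, averaging against them changes a variable only by its
  -- defects g T_i − T_i, which are polynomials in earlier variables.
  let y : Fin m → B := fun i => trace β (algebraMap A B c * e (MvPolynomial.X i))
  have hy : ∀ i, y i - e (MvPolynomial.X i) =
      ∑ g, α g c • (β g (e (MvPolynomial.X i)) - e (MvPolynomial.X i)) := by
    intro i
    simp only [y, trace, smul_sub, Finset.sum_sub_distrib, ← Finset.sum_smul]
    rw [show ∑ g, α g c = 1 from hc, one_smul]
    simp only [map_mul, hαβ, Algebra.smul_def]
  have hy' : ∀ i, y i - e (MvPolynomial.X i) ∈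
      Algebra.adjoin A ((fun j => e (MvPolynomial.X j)) '' {j | j < i}) := by
    intro i
    rw [hy]
    exact Subalgebra.sum_mem _ fun g _ => Subalgebra.smul_mem _ (h g i) _
  obtain ⟨φ, hφ⟩ := exists_equiv_of_unitriangular e y hy'
  refine ⟨φ, fun i => ?_, fun i => ?_⟩
  · rw [hφ]
    exact trace_mem_invariants β _
  · rw [hφ]
    exact hy' i

omit [Fintype G] in
theorem equivariant_of_invariant_variables (α : G →* (A ≃ₐ[k] A)) (β : G →* (B ≃ₐ[k] B))
    (hαβ : ∀ g a, β g (algebraMap A B a) = algebraMap A B (α g a))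
    (φ : MvPolynomial (Fin m) A ≃ₐ[A] B) (hφ : ∀ i, φ (MvPolynomial.X i) ∈ invariants β)
    (g : G) (q : MvPolynomial (Fin m) A) :
    φ (MvPolynomial.map (α g : A →+* A) q) = β g (φ q) := by
  induction q using MvPolynomial.induction_on with
  | C a =>
    rw [MvPolynomial.map_C]
    have h : ∀ a, φ (MvPolynomial.C a) = algebraMap A B a := fun a => φ.commutes a
    rw [h, h, hαβ]
    rfl
  | add p q hp hq => simp only [map_add, hp, hq]
  | mul_X p i hp => rw [map_mul, MvPolynomial.map_X, map_mul, hp, map_mul, map_mul, hφ i g]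

-- In invariant variables G acts on coefficients alone, so a polynomial is invariant exactly when
-- all its coefficients are.
omit [Fintype G] in
theorem exists_invariants_equiv [IsScalarTower k A B]
    (α : G →* (A ≃ₐ[k] A)) (β : G →* (B ≃ₐ[k] B))
    (hαβ : ∀ g a, β g (algebraMap A B a) = algebraMap A B (α g a))
    (φ : MvPolynomial (Fin m) A ≃ₐ[A] B) (hφ : ∀ i, φ (MvPolynomial.X i) ∈ invariants β) :
    ∃ ψ : MvPolynomial (Fin m) (invariants α) ≃ₐ[k] invariants β,
      ∀ q, (ψ q : B) = φ (MvPolynomial.map (algebraMap (invariants α) A) q) := by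
  have heq := equivariant_of_invariant_variables α β hαβ φ hφ
  let f : MvPolynomial (Fin m) (invariants α) →ₐ[k] B :=
    ((φ : MvPolynomial (Fin m) A →ₐ[A] B).restrictScalars k).comp
      (MvPolynomial.mapAlgHom (invariants α).val)
  have hf : ∀ q, f q = φ (MvPolynomial.map (algebraMap (invariants α) A) q) := fun q => rfl
  have hmem : ∀ q, f q ∈ invariants β := by
    intro q g
    have hg : (α g : A →+* A).comp (algebraMap (invariants α) A) = algebraMap (invariants α) A :=
      RingHom.ext fun a => a.2 g
    rw [hf, ← heq, MvPolynomial.map_map, hg]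
  have hinj : Function.Injective (f.codRestrict (invariants β) hmem) := by
    rw [AlgHom.injective_codRestrict]
    exact φ.injective.comp (MvPolynomial.map_injective _ Subtype.val_injective)
  have hsurj : Function.Surjective (f.codRestrict (invariants β) hmem) := by
    intro b
    have hb : ∀ g, MvPolynomial.map (α g : A →+* A) (φ.symm b) = φ.symm b := by
      intro g
      apply φ.injective
      rw [heq, φ.apply_symm_apply]
      exact b.2 g
    have hr : φ.symm (b : B) ∈ Set.range (MvPolynomial.map (σ := Fin m)
        (algebraMap (invariants α) A)) := by
      rw [MvPolynomial.mem_range_map_iff_coeffs_subset]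
      rintro a ha
      obtain ⟨d, -, rfl⟩ := MvPolynomial.mem_coeffs_iff.1 ha
      refine ⟨⟨(φ.symm (b : B)).coeff d, fun g => ?_⟩, rfl⟩
      conv_rhs => rw [← hb g]
      rw [MvPolynomial.coeff_map]
      rfl
    obtain ⟨q, hq⟩ := hr
    refine ⟨q, Subtype.ext ?_⟩
    change f q = b
    rw [hf, hq, φ.apply_symm_apply]
  exact ⟨AlgEquiv.ofBijective _ ⟨hinj, hsurj⟩, hf⟩

end TriangularExtension

/-! ### Base change of a triangular algebra, and lifting of morphisms -/

section TensorProduct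

variable {k G A B Γ : Type*} [CommRing k] [Group G] [CommRing A] [Algebra k A]
  [CommRing B] [Algebra k B] [CommRing Γ] [Algebra k Γ]

theorem tensorAction_tmul (α : G →* (A ≃ₐ[k] A)) (ρ : G →* (Γ ≃ₐ[k] Γ)) (g : G) (a : A) (x : Γ) :
    tensorAction α ρ g (a ⊗ₜ[k] x) = α g a ⊗ₜ[k] ρ g x := rfl

theorem tensorAction_algebraMap (α : G →* (A ≃ₐ[k] A)) (ρ : G →* (Γ ≃ₐ[k] Γ)) (g : G) (a : A) :
    tensorAction α ρ g (algebraMap A (A ⊗[k] Γ) a) = algebraMap A (A ⊗[k] Γ) (α g a) := by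
  rw [Algebra.TensorProduct.algebraMap_apply, Algebra.TensorProduct.algebraMap_apply,
    Algebra.algebraMap_self_apply, Algebra.algebraMap_self_apply, tensorAction_tmul, map_one]

variable [Fintype G]

/-- After base change to an algebra with a point of trace one, a triangular polynomial algebra is
generated by independent invariant variables. -/
theorem exists_tensor_invariant_variables [IsNoetherianRing A] {d : ℕ}
    (α : G →* (A ≃ₐ[k] A)) (ρ : G →* (Γ ≃ₐ[k] Γ)) {c : A} (hc : trace α c = 1)
    (e : MvPolynomial (Fin d) k ≃ₐ[k] Γ)
    (he : ∀ g i, ρ g (e (MvPolynomial.X i)) - e (MvPolynomial.X i) ∈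
      Algebra.adjoin k ((fun j => e (MvPolynomial.X j)) '' {j | j < i})) :
    ∃ φ : MvPolynomial (Fin d) A ≃ₐ[A] A ⊗[k] Γ,
      (∀ i, φ (MvPolynomial.X i) ∈ invariants (tensorAction α ρ)) ∧
      ∀ i, φ (MvPolynomial.X i) - 1 ⊗ₜ e (MvPolynomial.X i) ∈
        Algebra.adjoin A ((fun j => (1 : A) ⊗ₜ[k] e (MvPolynomial.X j)) '' {j | j < i}) := by
  obtain ⟨E, hE⟩ : ∃ E : MvPolynomial (Fin d) A ≃ₐ[A] A ⊗[k] Γ,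
      ∀ i, E (MvPolynomial.X i) = 1 ⊗ₜ e (MvPolynomial.X i) :=
    ⟨(MvPolynomial.algebraTensorAlgEquiv k A).symm.trans
      (Algebra.TensorProduct.congr AlgEquiv.refl e), fun i => by simp⟩
  have key := exists_invariant_variables α (tensorAction α ρ) (tensorAction_algebraMap α ρ) c hc E
  simp only [hE] at key
  refine key fun g i => ?_
  rw [tensorAction_tmul, map_one, ← TensorProduct.tmul_sub]
  have h1 : Algebra.adjoin k ((fun j => e (MvPolynomial.X j)) '' {j | j < i}) ≤
      ((Algebra.adjoin A ((fun j => (1 : A) ⊗ₜ[k] e (MvPolynomial.X j)) ''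
        {j | j < i})).restrictScalars k).comap Algebra.TensorProduct.includeRight := by
    refine Algebra.adjoin_le ?_
    rintro _ ⟨j, hj, rfl⟩
    exact Algebra.subset_adjoin ⟨j, hj, rfl⟩
  exact h1 (he g i)

omit [Fintype G] in
/-- Evaluating invariant variables at invariants gives a morphism. -/
theorem exists_equivariant_of_invariant_values {d : ℕ}
    (α : G →* (A ≃ₐ[k] A)) (ρ : G →* (Γ ≃ₐ[k] Γ))
    (φ : MvPolynomial (Fin d) A ≃ₐ[A] A ⊗[k] Γ)
    (hφ : ∀ i, φ (MvPolynomial.X i) ∈ invariants (tensorAction α ρ)) (a : Fin d → A)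
    (ha : ∀ i, a i ∈ invariants α) :
    ∃ h : Γ →ₐ[k] A, IsEquivariant ρ α h ∧
      ∀ x, h x = MvPolynomial.aeval a (φ.symm (1 ⊗ₜ x)) := by
  have heq := equivariant_of_invariant_variables α (tensorAction α ρ)
    (tensorAction_algebraMap α ρ) φ hφ
  refine ⟨(((MvPolynomial.aeval a).comp (φ.symm : A ⊗[k] Γ →ₐ[A] _)).restrictScalars k).comp
    Algebra.TensorProduct.includeRight, fun g x => ?_, fun x => rfl⟩
  change MvPolynomial.aeval a (φ.symm (1 ⊗ₜ ρ g x)) =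
    α g (MvPolynomial.aeval a (φ.symm (1 ⊗ₜ x)))
  have h1 : φ.symm (1 ⊗ₜ ρ g x) = MvPolynomial.map (α g : A →+* A) (φ.symm (1 ⊗ₜ x)) := by
    apply φ.injective
    rw [heq, φ.apply_symm_apply, φ.apply_symm_apply, tensorAction_tmul, map_one]
  rw [h1]
  generalize φ.symm (1 ⊗ₜ x) = q
  induction q using MvPolynomial.induction_on with
  | C b => simp
  | add p q hp hq => simp only [map_add, hp, hq]
  | mul_X p i hp =>
    simp only [map_mul, MvPolynomial.map_X, hp, MvPolynomial.aeval_X]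
    rw [ha i g]

/-- Morphisms from a triangular polynomial algebra lift along surjections. -/
theorem IsTriangularPolynomial.exists_lift [IsNoetherianRing A] {d : ℕ}
    {α : G →* (A ≃ₐ[k] A)} {β : G →* (B ≃ₐ[k] B)} {ρ : G →* (Γ ≃ₐ[k] Γ)}
    (hρ : IsTriangularPolynomial d ρ) {c : A} (hc : trace α c = 1) {f : A →ₐ[k] B}
    (hf : IsEquivariant α β f) (hfs : Function.Surjective f) {h : Γ →ₐ[k] B}
    (hh : IsEquivariant ρ β h) :
    ∃ h' : Γ →ₐ[k] A, IsEquivariant ρ α h' ∧ f.comp h' = h := by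
  obtain ⟨e, he⟩ := hρ
  obtain ⟨φ, hφ, -⟩ := exists_tensor_invariant_variables α ρ hc e he
  let μ : A ⊗[k] Γ →ₐ[k] B := Algebra.TensorProduct.productMap f h
  have hμ : IsEquivariant (tensorAction α ρ) β μ := by
    intro g x
    induction x using TensorProduct.induction_on with
    | zero => simp
    | tmul a x =>
      rw [tensorAction_tmul, Algebra.TensorProduct.productMap_apply_tmul,
        Algebra.TensorProduct.productMap_apply_tmul, hf, hh, map_mul]
    | add x y hx hy => simp only [map_add, hx, hy]
  -- These preimages of the invariant values need not be invariant. Replacing a_i by tr(c a_i) makes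
  -- them so and keeps their images.
  choose a ha using fun i => hfs (μ (φ (MvPolynomial.X i)))
  have hb : ∀ i, μ (φ (MvPolynomial.X i)) ∈ invariants β := by
    intro i g
    rw [← hμ, hφ i g]
  have ha' : ∀ i, f (trace α (c * a i)) = μ (φ (MvPolynomial.X i)) := by
    intro i
    rw [hf.map_trace, map_mul, ha, trace_mul_of_mem_invariants β (hb i), ← hf.map_trace, hc,
      map_one, one_mul]
  obtain ⟨h', hh', hval⟩ := exists_equivariant_of_invariant_values α ρ φ hφ
    (fun i => trace α (c * a i)) fun i => trace_mem_invariants α _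
  refine ⟨h', hh', AlgHom.ext fun x => ?_⟩
  have key : ∀ q, f (MvPolynomial.aeval (fun i => trace α (c * a i)) q) = μ (φ q) := by
    intro q
    induction q using MvPolynomial.induction_on with
    | C b =>
      have h1 : φ (MvPolynomial.C b) = b ⊗ₜ 1 := φ.commutes b
      rw [h1, Algebra.TensorProduct.productMap_apply_tmul, map_one, mul_one,
        MvPolynomial.aeval_C]
      rfl
    | add p q hp hq => simp only [map_add, hp, hq]
    | mul_X p i hp =>
      rw [map_mul, map_mul, hp, MvPolynomial.aeval_X, ha', map_mul, map_mul]
  rw [AlgHom.comp_apply, hval, key, φ.apply_symm_apply,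
    Algebra.TensorProduct.productMap_apply_tmul, map_one, one_mul]

end TensorProduct

/-! ### Sums over cosets -/

section QuotientSums

variable {G M : Type*} [Group G] [Fintype G] [AddCommMonoid M]

theorem sum_eq_sum_quotient (H : Subgroup G) [Fintype H] [Fintype (G ⧸ H)] (F : G → M) :
    ∑ x, F x = ∑ q : G ⧸ H, ∑ y : H, F (q.out * y) := by
  rw [← Fintype.sum_prod_type']
  symm
  refine Fintype.sum_bijective (fun x : (G ⧸ H) × H => x.1.out * x.2) ⟨?_, ?_⟩ _ _ fun _ => rfl
  · rintro ⟨q, y⟩ ⟨q', y'⟩ h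
    have hq : q = q' := by
      have := congrArg (QuotientGroup.mk (s := H)) h
      simpa using this
    subst hq
    have : (y : G) = y' := mul_left_cancel h
    rw [Subtype.ext this]
  · intro x
    have hx : (QuotientGroup.mk x : G ⧸ H).out⁻¹ * x ∈ H := by
      rw [← QuotientGroup.eq]
      exact QuotientGroup.out_eq' _
    exact ⟨(QuotientGroup.mk x, ⟨_, hx⟩), mul_inv_cancel_left _ _⟩

/-- F is constant on right cosets of ⟨g⟩; inversion turns these into the left cosets of
`sum_eq_sum_quotient`. -/
theorem exists_sum_eq_orderOf_nsmul (F : G → M) (g : G) (hF : ∀ x, F (g * x) = F x) :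
    ∃ y, ∑ x, F x = orderOf g • y := by
  classical
  have hz : ∀ (h : Subgroup.zpowers g) (x : G), F (h * x) = F x := by
    rintro ⟨_, j, rfl⟩ x
    change F (g ^ j * x) = F x
    induction j using Int.induction_on generalizing x with
    | zero => rw [zpow_zero, one_mul]
    | succ j ih => rw [zpow_add_one, mul_assoc, ih, hF]
    | pred j ih => rw [zpow_sub_one, mul_assoc, ih, ← hF, mul_inv_cancel_left]
  refine ⟨∑ q : G ⧸ Subgroup.zpowers g, F q.out⁻¹, ?_⟩
  rw [← Equiv.sum_comp (Equiv.inv G) F, sum_eq_sum_quotient (Subgroup.zpowers g),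
    Finset.smul_sum]
  refine Finset.sum_congr rfl fun q _ => ?_
  rw [← Fintype.card_zpowers, ← Finset.card_univ]
  refine Finset.sum_eq_card_nsmul fun y _ => ?_
  rw [Equiv.inv_apply, mul_inv_rev]
  exact hz y⁻¹ _

end QuotientSums

/-! ### The Galois property of p-groups in characteristic p -/

section Galois

variable {k G A B : Type*} [Field k] [Group G] [Fintype G] [CommRing A] [Algebra k A]
  [CommRing B] [Algebra k B]

theorem dvd_orderOf_of_card_eq_prime_pow {p n : ℕ} (hp : p.Prime)
    (hG : Fintype.card G = p ^ n) {g : G} (hg : g ≠ 1) : p ∣ orderOf g := by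
  obtain ⟨m, -, hm⟩ := (Nat.dvd_prime_pow hp).1 (hG ▸ orderOf_dvd_card (x := g))
  rw [hm]
  refine dvd_pow_self p ?_
  rintro rfl
  exact hg (orderOf_eq_one_iff.1 (by simpa using hm))

/-- For a `p`-group in characteristic `p`, a point of trace one separates the group elements. -/
theorem exists_separating_tensor {p n : ℕ} (hp : p.Prime) [CharP k p]
    (hG : Fintype.card G = p ^ n) (α : G →* (A ≃ₐ[k] A)) {c : A} (hc : trace α c = 1)
    {g : G} (hg : g ≠ 1) :
    ∃ x : A ⊗[k] A, Algebra.TensorProduct.productMap (AlgHom.id k A) (α 1 : A →ₐ[k] A) x = 1 ∧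
      Algebra.TensorProduct.productMap (AlgHom.id k A) (α g : A →ₐ[k] A) x = 0 := by
  let m : G → A ⊗[k] A →ₐ[k] A := fun g =>
    Algebra.TensorProduct.productMap (AlgHom.id k A) (α g : A →ₐ[k] A)
  have hm : ∀ g a b, m g (a ⊗ₜ b) = a * α g b := fun g a b =>
    Algebra.TensorProduct.productMap_apply_tmul _ _ _ _
  have hsurj : Function.Surjective (m 1) := fun a => ⟨a ⊗ₜ 1, by rw [hm, map_one, mul_one]⟩
  -- An element killed by m_g and sent to 1 by m_1 exists exactly when 1 lies in J.
  let J : Ideal A := (RingHom.ker (m g)).map (m 1 : A ⊗[k] A →+* A)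
  have hJ : ∀ s, s - α g s ∈ J := by
    intro s
    have h1 : (1 : A) ⊗ₜ[k] s - α g s ⊗ₜ[k] (1 : A) ∈ RingHom.ker (m g) := by
      rw [RingHom.mem_ker, map_sub, hm, hm, one_mul, map_one, mul_one, sub_self]
    have h2 := Ideal.mem_map_of_mem (m 1 : A ⊗[k] A →+* A) h1
    have h3 : m 1 ((1 : A) ⊗ₜ[k] s - α g s ⊗ₜ[k] (1 : A)) = s - α g s := by
      rw [map_sub, hm, hm, one_mul, map_one (α 1), mul_one, action_one_apply]
    rw [← h3]
    exact h2
  -- Modulo J the element g acts trivially, so the trace of c becomes a multiple of the order of g.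
  -- That order is divisible by p, hence 1 = tr c vanishes modulo J.
  have h1 : (1 : A) ∈ J := by
    obtain ⟨y, hy⟩ := exists_sum_eq_orderOf_nsmul (fun x => Ideal.Quotient.mk J (α x c)) g
      fun x => by
        rw [action_mul_apply]
        exact (Ideal.Quotient.eq.2 (hJ _)).symm
    rw [← map_sum, show ∑ x, α x c = 1 from hc] at hy
    rw [← Ideal.Quotient.eq_zero_iff_mem, hy]
    obtain ⟨r, hr⟩ := dvd_orderOf_of_card_eq_prime_pow hp hG hg
    have h0 : ((orderOf g : ℕ) : k) = 0 := by rw [hr, Nat.cast_mul, CharP.cast_eq_zero, zero_mul]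
    rw [← Nat.cast_smul_eq_nsmul k, h0, zero_smul]
  obtain ⟨x, hx, hx1⟩ := (Ideal.mem_map_iff_of_surjective _ hsurj).1 h1
  exact ⟨x, hx1, hx⟩

/-- The maps a ⊗ b ↦ a g(b) are multiplicative, so the product of separating tensors for all g ≠ 1
works. -/
theorem exists_galois_tensor {p n : ℕ} (hp : p.Prime) [CharP k p]
    (hG : Fintype.card G = p ^ n) (α : G →* (A ≃ₐ[k] A)) {c : A} (hc : trace α c = 1) :
    ∃ x : A ⊗[k] A, Algebra.TensorProduct.productMap (AlgHom.id k A) (α 1 : A →ₐ[k] A) x = 1 ∧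
      ∀ g, g ≠ 1 →
        Algebra.TensorProduct.productMap (AlgHom.id k A) (α g : A →ₐ[k] A) x = 0 := by
  classical
  choose! x hx1 hx0 using fun g (hg : g ≠ 1) => exists_separating_tensor hp hG α hc hg
  refine ⟨∏ g ∈ Finset.univ.erase 1, x g, ?_, fun g hg => ?_⟩
  · rw [map_prod]
    exact Finset.prod_eq_one fun g hg => hx1 g (Finset.ne_of_mem_erase hg)
  · rw [map_prod]
    exact Finset.prod_eq_zero (Finset.mem_erase.2 ⟨hg, Finset.mem_univ g⟩) (hx0 g hg)

/-- A morphism out of an algebra with a point of trace one which hits all invariants is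
surjective. -/
theorem surjective_of_invariants_le_range {p n : ℕ} (hp : p.Prime) [CharP k p]
    (hG : Fintype.card G = p ^ n) {α : G →* (A ≃ₐ[k] A)} {β : G →* (B ≃ₐ[k] B)} {c : A}
    (hc : trace α c = 1) {f : A →ₐ[k] B} (hf : IsEquivariant α β f)
    (hinv : invariants β ≤ f.range) : Function.Surjective f := by
  intro r
  obtain ⟨x, hx1, hx0⟩ := exists_galois_tensor hp hG α hc
  -- A pure tensor a ⊗ b contributes f(a) tr(f(b) r), which lies in the range. For the Galois tensor
  -- only the summand g = 1 survives, and it is r.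
  have key : ∀ x : A ⊗[k] A, ∑ g, f (Algebra.TensorProduct.productMap (AlgHom.id k A)
      (α g : A →ₐ[k] A) x) * β g r ∈ f.range := by
    intro x
    induction x using TensorProduct.induction_on with
    | zero => simp
    | tmul a b =>
      have h1 : f a * trace β (f b * r) ∈ f.range :=
        mul_mem ⟨a, rfl⟩ (hinv (trace_mem_invariants β _))
      convert h1 using 1
      rw [trace, Finset.mul_sum]
      refine Finset.sum_congr rfl fun g _ => ?_
      rw [Algebra.TensorProduct.productMap_apply_tmul, map_mul, map_mul, mul_assoc]
      congr 2
      exact hf g b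
    | add x y hx hy =>
      simp only [map_add, add_mul, Finset.sum_add_distrib]
      exact add_mem hx hy
  have h1 := key x
  rw [Finset.sum_eq_single 1, hx1, map_one, one_mul, action_one_apply] at h1
  · exact h1
  · intro g _ hg
    rw [hx0 g hg, map_zero, zero_mul]
  · intro h
    exact absurd (Finset.mem_univ _) h

end Galois

/-! ### Generation by images of morphisms; s-projectivity and the generator property -/

section Generators

variable {k G A B Γ : Type*} [Field k] [Group G] [Fintype G] [CommRing A] [Algebra k A]
  [CommRing B] [Algebra k B] [CommRing Γ] [Algebra k Γ]

omit [Fintype G] in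
theorem restrictAction_coe (ρ : G →* (A ≃ₐ[k] A)) (U : Subalgebra k A)
    (hU : ∀ g, ∀ u ∈ U, ρ g u ∈ U) (g : G) (u : U) :
    (restrictAction ρ U hU g u : A) = ρ g u := rfl

theorem coe_trace_restrictAction (ρ : G →* (A ≃ₐ[k] A)) (U : Subalgebra k A)
    (hU : ∀ g, ∀ u ∈ U, ρ g u ∈ U) (u : U) :
    ((trace (restrictAction ρ U hU) u : U) : A) = trace ρ u := by
  simp only [trace, AddSubmonoidClass.coe_finsetSum, restrictAction_coe]

/-- Without variables Γ = k has trivial action, and the trace is multiplication by |G| = 0. -/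
theorem IsTriangularPolynomial.ne_zero {p n d : ℕ} (hn : n ≠ 0) [CharP k p]
    (hG : Fintype.card G = p ^ n) {ρ : G →* (Γ ≃ₐ[k] Γ)} (hρ : IsTriangularPolynomial d ρ) {c : Γ}
    (hc : trace ρ c = 1) : d ≠ 0 := by
  rintro rfl
  obtain ⟨e, -⟩ := hρ
  have htriv : ∀ g x, ρ g x = x := by
    intro g x
    obtain ⟨y, rfl⟩ := e.surjective x
    obtain ⟨a, rfl⟩ := MvPolynomial.C_surjective (Fin 0) y
    have h : e (MvPolynomial.C a) = algebraMap k Γ a := e.commutes a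
    rw [h, (ρ g).commutes]
  have h0 : ((Fintype.card G : ℕ) : k) = 0 := by
    rw [hG, Nat.cast_pow, CharP.cast_eq_zero, zero_pow hn]
  have h1 : (0 : Γ) = 1 := by
    rw [← hc, trace, Finset.sum_congr rfl fun g _ => htriv g c, Finset.sum_const,
      Finset.card_univ, ← Nat.cast_smul_eq_nsmul k, h0, zero_smul]
  have h2 := congrArg e.symm h1
  rw [map_zero, map_one] at h2
  exact zero_ne_one h2

/-- The images of the morphisms from a triangular polynomial algebra in `𝔗𝔰` generate every
object. -/
theorem IsTriangularPolynomial.adjoin_images_eq_top {p n d : ℕ} (hp : p.Prime) (hn : n ≠ 0)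
    [CharP k p] (hG : Fintype.card G = p ^ n) {ρ : G →* (Γ ≃ₐ[k] Γ)}
    (hρ : IsTriangularPolynomial d ρ) {c : Γ} (hc : trace ρ c = 1) [IsNoetherianRing A]
    (α : G →* (A ≃ₐ[k] A)) {a : A} (ha : trace α a = 1) :
    Algebra.adjoin k {x | ∃ h : Γ →ₐ[k] A, IsEquivariant ρ α h ∧ x ∈ h.range} = ⊤ := by
  set S := Algebra.adjoin k {x | ∃ h : Γ →ₐ[k] A, IsEquivariant ρ α h ∧ x ∈ h.range} with hS
  have hd := hρ.ne_zero hn hG hc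
  obtain ⟨e, he⟩ := hρ
  obtain ⟨φ, hφ, hφe⟩ := exists_tensor_invariant_variables α ρ ha e he
  have hmem : ∀ (h : Γ →ₐ[k] A), IsEquivariant ρ α h → ∀ x, h x ∈ S := fun h hh x =>
    Algebra.subset_adjoin ⟨h, hh, x, rfl⟩
  have hstable : ∀ g, ∀ x ∈ S, α g x ∈ S := by
    intro g x hx
    have h1 : S ≤ S.comap (α g : A →ₐ[k] A) := by
      conv_lhs => rw [hS]
      refine Algebra.adjoin_le ?_
      rintro _ ⟨h, hh, y, rfl⟩
      change α g (h y) ∈ S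
      rw [← hh]
      exact hmem h hh _
    exact h1 hx
  have hval := exists_equivariant_of_invariant_values α ρ φ hφ
  have hinv : invariants α ≤ S := by
    intro r hr
    -- The first variable has no predecessors, so its invariant version differs from it by an
    -- element b of A. The morphisms with all invariant variables sent to r, respectively to 0, take
    -- the values r − b and −b on it, whose difference is r.
    let i : Fin d := ⟨0, Nat.pos_of_ne_zero hd⟩
    have hi : {j : Fin d | j < i} = ∅ := by
      ext j
      simp [i, Fin.lt_def]
    have h1 := hφe i
    rw [hi, Set.image_empty, Algebra.adjoin_empty] at h1
    obtain ⟨b, hb⟩ := h1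
    have h2 : φ.symm (1 ⊗ₜ e (MvPolynomial.X i)) = MvPolynomial.X i - MvPolynomial.C b := by
      apply φ.injective
      have h3 : φ (MvPolynomial.C b) = algebraMap A (A ⊗[k] Γ) b := φ.commutes b
      rw [φ.apply_symm_apply, map_sub, h3]
      change algebraMap A (A ⊗[k] Γ) b = _ at hb
      rw [hb, sub_sub_cancel]
    obtain ⟨h, hh, hhv⟩ := hval (fun _ => r) fun _ => hr
    obtain ⟨h', hh', hhv'⟩ := hval (fun _ => 0) fun _ => zero_mem _
    have h4 : r = h (e (MvPolynomial.X i)) - h' (e (MvPolynomial.X i)) := by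
      rw [hhv, hhv', h2]
      simp
    rw [h4]
    exact sub_mem (hmem h hh _) (hmem h' hh' _)
  obtain ⟨h, hh, -⟩ := hval (fun _ => 0) fun _ => zero_mem _
  -- Any morphism carries the point of Γ into S, so the Galois argument applies to the inclusion of
  -- S.
  have hpt : trace (restrictAction α S hstable) ⟨h c, hmem h hh c⟩ = 1 := by
    apply Subtype.ext
    rw [coe_trace_restrictAction]
    change trace α (h c) = 1
    rw [← hh.map_trace, hc, map_one]
  have hsurj := surjective_of_invariants_le_range hp hG hpt
    (f := S.val) (β := α) (fun g x => rfl) (by rwa [Subalgebra.range_val])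
  rw [← Subalgebra.range_val S, AlgHom.range_eq_top]
  exact hsurj

theorem IsTs.isNoetherianRing {α : G →* (A ≃ₐ[k] A)} (hα : IsTs α) : IsNoetherianRing A :=
  have := hα.1
  Algebra.FiniteType.isNoetherianRing k A

theorem IsTriangularPolynomial.isSProjective {d : ℕ} {ρ : G →* (Γ ≃ₐ[k] Γ)}
    (hρ : IsTriangularPolynomial d ρ) : IsSProjective.{t} ρ := by
  intro A B _ _ _ _ α β hα hβ f hf hfs h hh
  have := hα.isNoetherianRing
  obtain ⟨c, hc⟩ := hα.exists_point
  exact hρ.exists_lift hc hf hfs hh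

/-- Maps that agree after composition with every morphism Γ → A agree on a generating set of A. -/
theorem IsTriangularPolynomial.isGenerator {p n d : ℕ} (hp : p.Prime) (hn : n ≠ 0)
    [CharP k p] (hG : Fintype.card G = p ^ n) {ρ : G →* (Γ ≃ₐ[k] Γ)}
    (hρ : IsTriangularPolynomial d ρ) (hts : IsTs ρ) : IsGenerator.{t} ρ := by
  intro A B _ _ _ _ α β hα hβ f₁ f₂ hf₁ hf₂ hne
  have := hα.isNoetherianRing
  obtain ⟨a, ha⟩ := hα.exists_point
  obtain ⟨c, hc⟩ := hts.exists_point
  by_contra! hcon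
  refine hne (AlgHom.ext_of_adjoin_eq_top (hρ.adjoin_images_eq_top hp hn hG hc α ha) ?_)
  rintro _ ⟨h, hh, y, rfl⟩
  exact DFunLike.congr_fun (hcon h hh) y

end Generators

/-! ### Equivariant isomorphisms of tensor products -/

section Equivariance

variable {k G A B C D : Type*} [CommRing k] [Group G] [CommRing A] [Algebra k A]
  [CommRing B] [Algebra k B] [CommRing C] [Algebra k C] [CommRing D] [Algebra k D]

theorem IsEquivariant.trans {ρ : G →* (A ≃ₐ[k] A)} {σ : G →* (B ≃ₐ[k] B)} {τ : G →* (C ≃ₐ[k] C)}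
    {e : A ≃ₐ[k] B} {e' : B ≃ₐ[k] C} (he : IsEquivariant ρ σ (e : A →ₐ[k] B))
    (he' : IsEquivariant σ τ (e' : B →ₐ[k] C)) :
    IsEquivariant ρ τ (e.trans e' : A →ₐ[k] C) :=
  he'.comp he

theorem IsEquivariant.tensorCongr {ρ : G →* (A ≃ₐ[k] A)} {σ : G →* (B ≃ₐ[k] B)}
    {τ : G →* (C ≃ₐ[k] C)} {υ : G →* (D ≃ₐ[k] D)} {e : A ≃ₐ[k] B} {e' : C ≃ₐ[k] D}
    (he : IsEquivariant ρ σ (e : A →ₐ[k] B)) (he' : IsEquivariant τ υ (e' : C →ₐ[k] D)) :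
    IsEquivariant (tensorAction ρ τ) (tensorAction σ υ)
      (Algebra.TensorProduct.congr e e' : A ⊗[k] C →ₐ[k] B ⊗[k] D) := by
  intro g x
  induction x using TensorProduct.induction_on with
  | zero => simp
  | tmul a c => exact congrArg₂ (fun b d => b ⊗ₜ[k] d) (he g a) (he' g c)
  | add x y hx hy => simp only [map_add, hx, hy]

theorem isEquivariant_assoc (ρ : G →* (A ≃ₐ[k] A)) (σ : G →* (B ≃ₐ[k] B))
    (τ : G →* (C ≃ₐ[k] C)) :
    IsEquivariant (tensorAction (tensorAction ρ σ) τ) (tensorAction ρ (tensorAction σ τ))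
      (Algebra.TensorProduct.assoc k k k A B C : (A ⊗[k] B) ⊗[k] C →ₐ[k] A ⊗[k] (B ⊗[k] C)) := by
  intro g x
  induction x using TensorProduct.induction_on with
  | zero => simp
  | tmul y c =>
    induction y using TensorProduct.induction_on with
    | zero => simp
    | tmul a b => rfl
    | add x y hx hy => simp only [TensorProduct.add_tmul, map_add, hx, hy]
  | add x y hx hy => simp only [map_add, hx, hy]

theorem isEquivariant_comm (ρ : G →* (A ≃ₐ[k] A)) (σ : G →* (B ≃ₐ[k] B)) :
    IsEquivariant (tensorAction ρ σ) (tensorAction σ ρ)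
      (Algebra.TensorProduct.comm k A B : A ⊗[k] B →ₐ[k] B ⊗[k] A) := by
  intro g x
  induction x using TensorProduct.induction_on with
  | zero => simp
  | tmul a b => rfl
  | add x y hx hy => simp only [map_add, hx, hy]

theorem isEquivariant_refl (ρ : G →* (A ≃ₐ[k] A)) :
    IsEquivariant ρ ρ ((AlgEquiv.refl : A ≃ₐ[k] A) : A →ₐ[k] A) := fun _ _ => rfl

/-- Adjoining `m` invariant variables adjoins `m` variables to the ring of invariants. -/
theorem nonempty_invariants_tensor_mvPolynomial_equiv (ρ : G →* (A ≃ₐ[k] A)) (m : ℕ) :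
    Nonempty (MvPolynomial (Fin m) (invariants ρ) ≃ₐ[k]
      invariants (tensorAction ρ (1 : G →* (MvPolynomial (Fin m) k ≃ₐ[k] _)))) := by
  obtain ⟨ψ, -⟩ := exists_invariants_equiv ρ
    (tensorAction ρ (1 : G →* (MvPolynomial (Fin m) k ≃ₐ[k] _)))
    (tensorAction_algebraMap ρ _) (MvPolynomial.algebraTensorAlgEquiv k A).symm fun i g => by
      rw [MvPolynomial.algebraTensorAlgEquiv_symm_X, tensorAction_tmul, map_one]
      rfl
  exact ⟨ψ⟩

/-- Tensoring with a triangular polynomial algebra adjoins invariant variables. -/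
theorem IsTriangularPolynomial.exists_tensor_equiv [Fintype G] [IsNoetherianRing A] {d : ℕ}
    {ρ : G →* (B ≃ₐ[k] B)} (hρ : IsTriangularPolynomial d ρ) {α : G →* (A ≃ₐ[k] A)} {c : A}
    (hc : trace α c = 1) :
    ∃ e : A ⊗[k] B ≃ₐ[k] A ⊗[k] MvPolynomial (Fin d) k,
      IsEquivariant (tensorAction α ρ) (tensorAction α 1)
        (e : A ⊗[k] B →ₐ[k] A ⊗[k] MvPolynomial (Fin d) k) := by
  obtain ⟨e, he⟩ := hρ
  obtain ⟨φ, hφ, -⟩ := exists_tensor_invariant_variables α ρ hc e he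
  let E : A ⊗[k] MvPolynomial (Fin d) k ≃ₐ[k] A ⊗[k] B :=
    ((MvPolynomial.algebraTensorAlgEquiv k A).trans φ).restrictScalars k
  refine ⟨E.symm, IsEquivariant.symm fun g x => ?_⟩
  have heq := equivariant_of_invariant_variables α (tensorAction α ρ)
    (tensorAction_algebraMap α ρ) φ hφ g
  change φ (MvPolynomial.algebraTensorAlgEquiv k A _) =
    tensorAction α ρ g (φ (MvPolynomial.algebraTensorAlgEquiv k A x))
  rw [← heq]
  congr 1
  induction x using TensorProduct.induction_on with
  | zero => simp
  | tmul a p =>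
    rw [tensorAction_tmul, MvPolynomial.algebraTensorAlgEquiv_tmul,
      MvPolynomial.algebraTensorAlgEquiv_tmul, MvPolynomial.smul_eq_C_mul,
      MvPolynomial.smul_eq_C_mul, map_mul, MvPolynomial.map_C, MvPolynomial.map_map]
    congr 2
    exact congrArg MvPolynomial.map (RingHom.ext fun r => ((α g).commutes r).symm)
  | add x y hx hy => simp only [map_add, hx, hy]

theorem nonempty_mvPolynomial_tensor_equiv (R : Type*) [CommRing R] (m N : ℕ) :
    Nonempty (MvPolynomial (Fin m) R ⊗[R] MvPolynomial (Fin N) R ≃ₐ[R]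
      MvPolynomial (Fin (N + m)) R) :=
  ⟨((MvPolynomial.algebraTensorAlgEquiv R (MvPolynomial (Fin m) R)).restrictScalars R).trans
    ((MvPolynomial.sumAlgEquiv R (Fin N) (Fin m)).symm.trans
      (MvPolynomial.renameEquiv R finSumFinEquiv))⟩

end Equivariance

/-! ### Tensor powers and their invariants -/

section TensorPower

variable {k G A S : Type*} [CommRing k] [Group G] [CommRing A] [Algebra k A]
  [CommRing S] [Algebra k S] {ℓ : ℕ}

/-- The algebra homomorphism on a tensor power induced by a family of homomorphisms. -/
def tensorPowerLift (f : Fin ℓ → (A →ₐ[k] S)) : (⨂[k] _ : Fin ℓ, A) →ₐ[k] S :=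
  PiTensorProduct.liftAlgHom
    ((MultilinearMap.mkPiAlgebra k (Fin ℓ) S).compLinearMap fun i => (f i).toLinearMap)
    (by simp)
    (by
      intro x y
      simp [Finset.prod_mul_distrib])

/-- The inclusion of a tensor factor into a tensor power. -/
abbrev tensorPowerSingle (k : Type*) {A : Type*} [CommRing k] [CommRing A] [Algebra k A] {ℓ : ℕ}
    (i : Fin ℓ) : A →ₐ[k] (⨂[k] _ : Fin ℓ, A) :=
  PiTensorProduct.singleAlgHom (R := k) (A := fun _ : Fin ℓ => A) i

theorem tensorPowerLift_single (f : Fin ℓ → (A →ₐ[k] S)) (i : Fin ℓ) (a : A) :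
    tensorPowerLift f (tensorPowerSingle k i a) = f i a := by
  change PiTensorProduct.lift _ (PiTensorProduct.tprod k _) = _
  rw [PiTensorProduct.lift.tprod, MultilinearMap.compLinearMap_apply,
    MultilinearMap.mkPiAlgebra_apply, Finset.prod_eq_single i]
  · simp
  · intro j _ hj
    simp [Pi.mulSingle_eq_of_ne hj]
  · intro h
    exact absurd (Finset.mem_univ i) h

theorem tensorPowerAction_single (ρ : G →* (A ≃ₐ[k] A)) (g : G) (i : Fin ℓ) (a : A) :
    tensorPowerAction ℓ ρ g (tensorPowerSingle k i a) = tensorPowerSingle k i (ρ g a) := by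
  change tensorPowerHom ℓ (ρ g) (PiTensorProduct.tprod k _) = PiTensorProduct.tprod k _
  rw [tensorPowerHom_tprod]
  congr 1
  ext j
  rcases eq_or_ne j i with rfl | hj
  · simp
  · simp [Pi.mulSingle_eq_of_ne hj]

theorem isEquivariant_of_tensorPowerSingle {ρ : G →* (A ≃ₐ[k] A)} {σ : G →* (S ≃ₐ[k] S)}
    {F : (⨂[k] _ : Fin ℓ, A) →ₐ[k] S}
    (h : ∀ g i a, F (tensorPowerSingle k i (ρ g a)) = σ g (F (tensorPowerSingle k i a))) :
    IsEquivariant (tensorPowerAction ℓ ρ) σ F := by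
  intro g x
  have : F.comp (tensorPowerAction ℓ ρ g : (⨂[k] _ : Fin ℓ, A) →ₐ[k] (⨂[k] _ : Fin ℓ, A)) =
      (σ g : S →ₐ[k] S).comp F := by
    refine PiTensorProduct.algHom_ext fun i => AlgHom.ext fun a => ?_
    have h1 := tensorPowerAction_single ρ g i a
    exact (congrArg F h1).trans (h g i a)
  exact DFunLike.congr_fun this x

/-- The factor with zero variables gives the base case the shape needed for induction on ℓ. -/
theorem exists_tensorPower_one_equiv (ρ : G →* (A ≃ₐ[k] A)) :
    ∃ e : (⨂[k] _ : Fin 1, A) ≃ₐ[k] A ⊗[k] MvPolynomial (Fin 0) k,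
      IsEquivariant (tensorPowerAction 1 ρ) (tensorAction ρ 1)
        (e : (⨂[k] _ : Fin 1, A) →ₐ[k] A ⊗[k] MvPolynomial (Fin 0) k) := by
  let F : (⨂[k] _ : Fin 1, A) →ₐ[k] A ⊗[k] MvPolynomial (Fin 0) k :=
    tensorPowerLift fun _ => Algebra.TensorProduct.includeLeft
  let F' : A ⊗[k] MvPolynomial (Fin 0) k →ₐ[k] (⨂[k] _ : Fin 1, A) :=
    Algebra.TensorProduct.productMap (tensorPowerSingle k 0) (MvPolynomial.aeval Fin.elim0)
  have hF : ∀ i a, F (tensorPowerSingle k i a) = a ⊗ₜ 1 := fun i a =>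
    tensorPowerLift_single _ i a
  refine ⟨AlgEquiv.ofAlgHom F F' ?_ ?_, isEquivariant_of_tensorPowerSingle fun g i a => ?_⟩
  · refine Algebra.TensorProduct.ext (AlgHom.ext fun a => ?_)
      (MvPolynomial.algHom_ext fun i => i.elim0)
    change F (F' (a ⊗ₜ 1)) = a ⊗ₜ 1
    rw [Algebra.TensorProduct.productMap_apply_tmul, map_one, mul_one, hF]
  · refine PiTensorProduct.algHom_ext fun i => AlgHom.ext fun a => ?_
    change F' (F (tensorPowerSingle k i a)) = tensorPowerSingle k i a
    rw [hF, Algebra.TensorProduct.productMap_apply_tmul, map_one, mul_one, Subsingleton.elim i 0]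
  · change F _ = tensorAction ρ 1 g (F _)
    rw [hF, hF]
    rfl

theorem exists_tensorPower_succ_equiv (ρ : G →* (A ≃ₐ[k] A)) (ℓ : ℕ) :
    ∃ e : (⨂[k] _ : Fin (ℓ + 1), A) ≃ₐ[k] A ⊗[k] (⨂[k] _ : Fin ℓ, A),
      IsEquivariant (tensorPowerAction (ℓ + 1) ρ) (tensorAction ρ (tensorPowerAction ℓ ρ))
        (e : (⨂[k] _ : Fin (ℓ + 1), A) →ₐ[k] A ⊗[k] (⨂[k] _ : Fin ℓ, A)) := by
  let F : (⨂[k] _ : Fin (ℓ + 1), A) →ₐ[k] A ⊗[k] (⨂[k] _ : Fin ℓ, A) :=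
    tensorPowerLift (Fin.cons Algebra.TensorProduct.includeLeft
      fun i => Algebra.TensorProduct.includeRight.comp (tensorPowerSingle k i))
  let F' : A ⊗[k] (⨂[k] _ : Fin ℓ, A) →ₐ[k] (⨂[k] _ : Fin (ℓ + 1), A) :=
    Algebra.TensorProduct.productMap (tensorPowerSingle k 0)
      (tensorPowerLift fun i => tensorPowerSingle k i.succ)
  have hF0 : ∀ a, F (tensorPowerSingle k 0 a) = a ⊗ₜ 1 := fun a => tensorPowerLift_single _ 0 a
  have hF : ∀ i a, F (tensorPowerSingle k (Fin.succ i) a) = 1 ⊗ₜ tensorPowerSingle k i a :=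
    fun i a => tensorPowerLift_single _ i.succ a
  have hF' : ∀ i a, F' (1 ⊗ₜ tensorPowerSingle k i a) = tensorPowerSingle k (Fin.succ i) a := by
    intro i a
    rw [Algebra.TensorProduct.productMap_apply_tmul, map_one, one_mul, tensorPowerLift_single]
  have hF0' : ∀ a, F' (a ⊗ₜ 1) = tensorPowerSingle k 0 a := by
    intro a
    rw [Algebra.TensorProduct.productMap_apply_tmul, map_one, mul_one]
  refine ⟨AlgEquiv.ofAlgHom F F' ?_ ?_, isEquivariant_of_tensorPowerSingle fun g i a => ?_⟩
  · refine Algebra.TensorProduct.ext (AlgHom.ext fun a => ?_)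
      (PiTensorProduct.algHom_ext fun i => AlgHom.ext fun a => ?_)
    · change F (F' (a ⊗ₜ 1)) = a ⊗ₜ 1
      rw [hF0', hF0]
    · change F (F' (1 ⊗ₜ tensorPowerSingle k i a)) = 1 ⊗ₜ tensorPowerSingle k i a
      rw [hF', hF]
  · refine PiTensorProduct.algHom_ext fun i => AlgHom.ext fun a => ?_
    change F' (F (tensorPowerSingle k i a)) = tensorPowerSingle k i a
    refine Fin.cases ?_ (fun i => ?_) i
    · rw [hF0, hF0']
    · rw [hF, hF']
  · change F _ = tensorAction ρ (tensorPowerAction ℓ ρ) g (F _)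
    refine Fin.cases ?_ (fun i => ?_) i
    · rw [hF0, hF0, tensorAction_tmul, map_one]
    · rw [hF, hF, tensorAction_tmul, map_one, tensorPowerAction_single]

variable [Fintype G]

/-- Each further factor A stands beside a copy of A that has a point, and there it dissolves into d
invariant variables. -/
theorem IsTriangularPolynomial.exists_tensorPower_equiv [IsNoetherianRing A] {d : ℕ}
    {ρ : G →* (A ≃ₐ[k] A)} (hρ : IsTriangularPolynomial d ρ) {c : A} (hc : trace ρ c = 1)
    (hℓ : 1 ≤ ℓ) :
    ∃ (N : ℕ) (e : (⨂[k] _ : Fin ℓ, A) ≃ₐ[k] A ⊗[k] MvPolynomial (Fin N) k),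
      IsEquivariant (tensorPowerAction ℓ ρ) (tensorAction ρ 1)
        (e : (⨂[k] _ : Fin ℓ, A) →ₐ[k] A ⊗[k] MvPolynomial (Fin N) k) := by
  induction ℓ, hℓ using Nat.le_induction with
  | base => exact ⟨0, exists_tensorPower_one_equiv ρ⟩
  | succ ℓ _ ih =>
    obtain ⟨N, e, he⟩ := ih
    obtain ⟨e₁, he₁⟩ := exists_tensorPower_succ_equiv ρ ℓ
    obtain ⟨e₂, he₂⟩ := hρ.exists_tensor_equiv hc
    obtain ⟨e₃⟩ := nonempty_mvPolynomial_tensor_equiv k d N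
    have h₁ := he₁.trans ((isEquivariant_refl ρ).tensorCongr he)
    have h₂ := h₁.trans (isEquivariant_assoc ρ ρ 1).symm
    have h₃ := h₂.trans (he₂.tensorCongr (isEquivariant_refl 1))
    have h₄ := h₃.trans (isEquivariant_assoc ρ 1 1)
    have h₅ : IsEquivariant (tensorAction (1 : G →* (MvPolynomial (Fin d) k ≃ₐ[k] _))
        (1 : G →* (MvPolynomial (Fin N) k ≃ₐ[k] _))) 1
        (e₃ : _ →ₐ[k] MvPolynomial (Fin (N + d)) k) := by
      intro g x
      have : tensorAction (1 : G →* (MvPolynomial (Fin d) k ≃ₐ[k] _))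
          (1 : G →* (MvPolynomial (Fin N) k ≃ₐ[k] _)) = 1 := by
        refine MonoidHom.ext fun g => AlgEquiv.ext fun x => ?_
        induction x using TensorProduct.induction_on with
        | zero => simp
        | tmul a b => rfl
        | add x y hx hy => rw [map_add, map_add, hx, hy]
      rw [this]
      rfl
    exact ⟨N + d, _, h₄.trans ((isEquivariant_refl ρ).tensorCongr h₅)⟩

/-- The invariants of a tensor power form a polynomial ring over the invariants. -/
theorem IsTriangularPolynomial.exists_invariants_tensorPower_equiv [IsNoetherianRing A] {d : ℕ}
    {ρ : G →* (A ≃ₐ[k] A)} (hρ : IsTriangularPolynomial d ρ) {c : A} (hc : trace ρ c = 1)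
    (hℓ : 1 ≤ ℓ) :
    ∃ N : ℕ, Nonempty (invariants (tensorPowerAction ℓ ρ) ≃ₐ[k]
      MvPolynomial (Fin N) (invariants ρ)) := by
  obtain ⟨N, e, he⟩ := hρ.exists_tensorPower_equiv hc hℓ
  obtain ⟨e₁⟩ := he.nonempty_invariants_equiv
  obtain ⟨e₂⟩ := nonempty_invariants_tensor_mvPolynomial_equiv ρ N
  exact ⟨N, ⟨e₁.trans e₂.symm⟩⟩

theorem nonempty_mvPolynomial_mvPolynomial_equiv {R : Type*} [CommRing R] [Algebra k R] {m : ℕ}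
    (e : R ≃ₐ[k] MvPolynomial (Fin m) k) (N : ℕ) :
    Nonempty (MvPolynomial (Fin N) R ≃ₐ[k] MvPolynomial (Fin (N + m)) k) :=
  ⟨(MvPolynomial.mapAlgEquiv (Fin N) e).trans
    ((MvPolynomial.sumAlgEquiv k (Fin N) (Fin m)).symm.trans
      (MvPolynomial.renameEquiv k finSumFinEquiv))⟩

theorem IsTriangularPolynomial.isPolynomialRing_invariants_tensorPower [IsNoetherianRing A]
    {d : ℕ} {ρ : G →* (A ≃ₐ[k] A)} (hρ : IsTriangularPolynomial d ρ) {c : A}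
    (hc : trace ρ c = 1) (hpoly : IsPolynomialRing k (invariants ρ)) (hℓ : 1 ≤ ℓ) :
    IsPolynomialRing k (invariants (tensorPowerAction ℓ ρ)) := by
  obtain ⟨N, ⟨e⟩⟩ := hρ.exists_invariants_tensorPower_equiv hc hℓ
  obtain ⟨m, ⟨e'⟩⟩ := hpoly
  obtain ⟨e''⟩ := nonempty_mvPolynomial_mvPolynomial_equiv e' N
  exact ⟨N + m, ⟨e.trans e''⟩⟩

/-- If one triangular polynomial algebra with a point has a polynomial ring of invariants, the
invariants of the tensor powers of all the others are stably polynomial. -/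
theorem IsTriangularPolynomial.isStablyPolynomial_invariants_tensorPower [IsNoetherianRing A]
    [IsNoetherianRing S] {d n : ℕ} {ρ : G →* (A ≃ₐ[k] A)} {σ : G →* (S ≃ₐ[k] S)}
    (hρ : IsTriangularPolynomial d ρ) {c : A} (hc : trace ρ c = 1)
    (hσ : IsTriangularPolynomial n σ) {b : S} (hb : trace σ b = 1)
    (hpoly : IsPolynomialRing k (invariants σ)) (hℓ : 1 ≤ ℓ) :
    IsStablyPolynomial k (invariants (tensorPowerAction ℓ ρ)) := by
  obtain ⟨N, ⟨e⟩⟩ := hρ.exists_invariants_tensorPower_equiv hc hℓ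
  obtain ⟨m, ⟨e₀⟩⟩ := hpoly
  -- The invariants of A ⊗ S are read in two ways: as A^G in n further variables and as S^G in d
  -- further variables. The latter is polynomial over k.
  obtain ⟨e₁, he₁⟩ := hσ.exists_tensor_equiv hc
  obtain ⟨e₂, he₂⟩ := hρ.exists_tensor_equiv hb
  obtain ⟨i₁⟩ := ((he₁.symm.trans (isEquivariant_comm ρ σ)).trans he₂).nonempty_invariants_equiv
  obtain ⟨i₂⟩ := nonempty_invariants_tensor_mvPolynomial_equiv ρ n
  obtain ⟨i₃⟩ := nonempty_invariants_tensor_mvPolynomial_equiv σ d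
  obtain ⟨i₄⟩ := nonempty_mvPolynomial_mvPolynomial_equiv e₀ d
  have i₅ : MvPolynomial (Fin n) (invariants ρ) ≃ₐ[k] MvPolynomial (Fin (d + m)) k :=
    i₂.trans (i₁.trans (i₃.symm.trans i₄))
  obtain ⟨i₆⟩ := nonempty_mvPolynomial_mvPolynomial_equiv i₅ N
  refine ⟨n, N + (d + m), ⟨(MvPolynomial.mapAlgEquiv (Fin n) e).trans (AlgEquiv.trans ?_ i₆)⟩⟩
  exact ((MvPolynomial.commAlgEquiv (invariants ρ) (Fin n) (Fin N)).restrictScalars k)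

end TensorPower

/-! ### The s-generator property -/

section SGenerator

variable {k G Γ : Type*} [Field k] [Group G] [Fintype G] [CommRing Γ] [Algebra k Γ]

/-- Each of the finitely many generators of R involves the images of finitely many morphisms.
Together these form one map from a tensor power. -/
theorem IsTriangularPolynomial.isSGenerator {p n d : ℕ} (hp : p.Prime) (hn : n ≠ 0)
    [CharP k p] (hG : Fintype.card G = p ^ n) {ρ : G →* (Γ ≃ₐ[k] Γ)}
    (hρ : IsTriangularPolynomial d ρ) (hts : IsTs ρ) : IsSGenerator.{t} ρ := by
  intro R _ _ σ hσ
  have := hσ.isNoetherianRing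
  obtain ⟨a, ha⟩ := hσ.exists_point
  obtain ⟨c, hc⟩ := hts.exists_point
  have htop := hρ.adjoin_images_eq_top hp hn hG hc σ ha
  obtain ⟨e, he⟩ := hρ
  obtain ⟨φ, hφ, -⟩ := exists_tensor_invariant_variables σ ρ ha e he
  obtain ⟨h₀, hh₀, -⟩ := exists_equivariant_of_invariant_values σ ρ φ hφ (fun _ => 0)
    fun _ => zero_mem _
  let S : List (Γ →ₐ[k] R) → Subalgebra k R := fun L =>
    Algebra.adjoin k {x | ∃ h ∈ L, x ∈ h.range}
  have hmono : ∀ {L L' : List (Γ →ₐ[k] R)}, L ⊆ L' → S L ≤ S L' := fun hL =>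
    Algebra.adjoin_mono fun x ⟨h, hh, hx⟩ => ⟨h, hL hh, hx⟩
  have hmem : ∀ x : R, ∃ L : List (Γ →ₐ[k] R), (∀ h ∈ L, IsEquivariant ρ σ h) ∧ x ∈ S L := by
    intro x
    have hx : x ∈ Algebra.adjoin k {x | ∃ h : Γ →ₐ[k] R, IsEquivariant ρ σ h ∧ x ∈ h.range} := by
      rw [htop]
      trivial
    induction hx using Algebra.adjoin_induction with
    | mem x hx =>
      obtain ⟨h, hh, hx⟩ := hx
      exact ⟨[h], by simpa using hh, Algebra.subset_adjoin ⟨h, by simp, hx⟩⟩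
    | algebraMap r => exact ⟨[], by simp, Subalgebra.algebraMap_mem _ r⟩
    | add x y _ _ hx hy =>
      obtain ⟨L, hL, hx⟩ := hx
      obtain ⟨L', hL', hy⟩ := hy
      refine ⟨L ++ L', fun h hh => (List.mem_append.1 hh).elim (hL h) (hL' h), add_mem ?_ ?_⟩
      · exact hmono (List.subset_append_left _ _) hx
      · exact hmono (List.subset_append_right _ _) hy
    | mul x y _ _ hx hy =>
      obtain ⟨L, hL, hx⟩ := hx
      obtain ⟨L', hL', hy⟩ := hy
      refine ⟨L ++ L', fun h hh => (List.mem_append.1 hh).elim (hL h) (hL' h), mul_mem ?_ ?_⟩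
      · exact hmono (List.subset_append_left _ _) hx
      · exact hmono (List.subset_append_right _ _) hy
  obtain ⟨s, hs⟩ := hσ.1.out
  choose L hL hLx using hmem
  -- The extra morphism h₀ only ensures ℓ ≥ 1.
  let M : List (Γ →ₐ[k] R) := h₀ :: s.toList.flatMap L
  have hM : ∀ h ∈ M, IsEquivariant ρ σ h := by
    intro h hh
    rcases List.mem_cons.1 hh with rfl | hh
    · exact hh₀
    · obtain ⟨x, -, hx⟩ := List.mem_flatMap.1 hh
      exact hL x h hx
  have hMtop : S M = ⊤ := by
    rw [eq_top_iff, ← hs]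
    refine Algebra.adjoin_le fun x hx => hmono (fun h hh => ?_) (hLx x)
    exact List.mem_cons_of_mem _ (List.mem_flatMap.2 ⟨x, Finset.mem_toList.2 hx, hh⟩)
  refine ⟨M.length, by simp [M], tensorPowerLift fun i => M.get i,
    isEquivariant_of_tensorPowerSingle fun g i a => ?_, ?_⟩
  · rw [tensorPowerLift_single, tensorPowerLift_single]
    exact hM _ (M.get_mem i) g a
  · rw [← AlgHom.range_eq_top, eq_top_iff, ← hMtop]
    refine Algebra.adjoin_le ?_
    rintro _ ⟨h, hh, y, rfl⟩
    obtain ⟨i, rfl⟩ := List.mem_iff_get.1 hh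
    exact ⟨tensorPowerSingle k i y, tensorPowerLift_single _ _ _⟩

end SGenerator

/-! ### Power sums over the prime field -/

section PowerSums

variable {p : ℕ} [Fact p.Prime] {R : Type*} [CommRing R]

/-- In the binomial expansion all power sums of exponent below p − 1 vanish, and the sum of a^{p−1}
is −1. -/
theorem sum_add_zmod_pow (ι : ZMod p →+* R) (x : R) :
    ∑ a, (x + ι a) ^ (p - 1) = -1 := by
  have hp : 1 < p := (Fact.out : p.Prime).one_lt
  simp only [add_pow, ← map_pow]
  rw [Finset.sum_comm]
  have h : ∀ m ∈ Finset.range (p - 1 + 1), ∑ a : ZMod p, x ^ m * ι (a ^ (p - 1 - m)) *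
      ((p - 1).choose m : R) =
        x ^ m * ι (∑ a : ZMod p, a ^ (p - 1 - m)) * ((p - 1).choose m : R) := by
    intro m _
    rw [map_sum, Finset.mul_sum, Finset.sum_mul]
  rw [Finset.sum_congr rfl h, Finset.sum_eq_single 0]
  · have h1 : ∑ a : ZMod p, a ^ (p - 1) = -1 := by
      have h2 : ∀ a : ZMod p, a ^ (p - 1) = 1 - if a = 0 then 1 else 0 := by
        intro a
        split_ifs with ha
        · rw [ha, zero_pow (by omega), sub_self]
        · rw [ZMod.pow_card_sub_one_eq_one ha, sub_zero]
      simp [h2]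
    rw [Nat.sub_zero, h1]
    simp
  · intro m _ hm
    have h1 : ∑ a : ZMod p, a ^ (p - 1 - m) = 0 :=
      FiniteField.sum_pow_lt_card_sub_one _ _ (by rw [ZMod.card]; omega)
    rw [h1]
    simp
  · intro h
    simp at h

/-- From (x + a)^p = x^p + a one gets a(x + a)^{p−1} = x^p + a − x(x + a)^{p−1}. The sum of all a is
kept because it is nonzero for p = 2. -/
theorem sum_zmod_mul_add_pow [CharP R p] (ι : ZMod p →+* R) (x : R) :
    ∑ a, ι a * (x + ι a) ^ (p - 1) = x + ι (∑ a, a) := by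
  have hp : 1 ≤ p := (Fact.out : p.Prime).one_lt.le
  have h : ∀ a, ι a * (x + ι a) ^ (p - 1) = x ^ p + ι a - x * (x + ι a) ^ (p - 1) := by
    intro a
    have h1 : (x + ι a) ^ p = x ^ p + ι a := by
      rw [add_pow_char, ← map_pow, ZMod.pow_card]
    have h2 : (x + ι a) ^ (p - 1) * (x + ι a) = (x + ι a) ^ p := by
      rw [← pow_succ, Nat.sub_add_cancel hp]
    rw [← h1, ← h2]
    ring
  simp only [h, Finset.sum_sub_distrib, Finset.sum_add_distrib, ← Finset.mul_sum]
  rw [sum_add_zmod_pow, Finset.sum_const, Finset.card_univ, ZMod.card, ← map_sum, nsmul_eq_mul,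
    CharP.cast_eq_zero]
  ring

end PowerSums

/-! ### Actions on A[X] given by cocycles -/

section PolynomialAction

open Polynomial

variable {k G A : Type*} [CommRing k] [Group G] [CommRing A] [Algebra k A]

/-- The substitution `∑ aᵢ Xⁱ ↦ ∑ σ(aᵢ) (X + b)ⁱ`. -/
def affineSubst (σ : A ≃ₐ[k] A) (b : A) : A[X] →ₐ[k] A[X] :=
  ((aeval (X + C b) : A[X] →ₐ[A] A[X]).restrictScalars k).comp (mapAlgHom (σ : A →ₐ[k] A))

theorem affineSubst_apply (σ : A ≃ₐ[k] A) (b : A) (P : A[X]) :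
    affineSubst σ b P = (P.map (σ : A →+* A)).comp (X + C b) := rfl

theorem affineSubst_C (σ : A ≃ₐ[k] A) (b a : A) : affineSubst σ b (C a) = C (σ a) := by
  simp [affineSubst_apply]

theorem affineSubst_X (σ : A ≃ₐ[k] A) (b : A) : affineSubst σ b X = X + C b := by
  simp [affineSubst_apply]

theorem polynomial_algHom_ext {B : Type*} [CommRing B] [Algebra k B] {f g : A[X] →ₐ[k] B}
    (hC : ∀ a, f (C a) = g (C a)) (hX : f X = g X) : f = g := by
  have h : (f : A[X] →+* B) = (g : A[X] →+* B) := Polynomial.ringHom_ext hC hX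
  exact AlgHom.ext fun x => RingHom.congr_fun h x

/-- The translation part `a + σ b` is what the cocycle identity prescribes for a product. -/
theorem affineSubst_comp (σ τ : A ≃ₐ[k] A) (a b : A) (P : A[X]) :
    affineSubst σ a (affineSubst τ b P) = affineSubst (σ * τ) (a + σ b) P := by
  have : (affineSubst σ a).comp (affineSubst τ b) = affineSubst (σ * τ) (a + σ b) := by
    refine polynomial_algHom_ext (fun x => ?_) ?_
    · simp only [AlgHom.comp_apply, affineSubst_C, AlgEquiv.mul_apply]
    · simp only [AlgHom.comp_apply, affineSubst_C, affineSubst_X, map_add, add_assoc]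
  exact DFunLike.congr_fun this P

theorem affineSubst_one (P : A[X]) : affineSubst (1 : A ≃ₐ[k] A) 0 P = P := by
  have : affineSubst (1 : A ≃ₐ[k] A) 0 = AlgHom.id k A[X] := by
    refine polynomial_algHom_ext (fun x => ?_) ?_
    · simp [affineSubst_C]
    · simp [affineSubst_X]
  exact DFunLike.congr_fun this P

/-- The action on `A[X]` extending an action on `A` by `g(X) = X + f(g)`, for a cocycle `f`. -/
def cocycleAction (α : G →* (A ≃ₐ[k] A)) (f : G → A) (hf : ∀ g h, f (g * h) = f g + α g (f h)) :
    G →* (A[X] ≃ₐ[k] A[X]) :=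
  have h1 : f 1 = 0 := by simpa using hf 1 1
  have hinv : ∀ g P, affineSubst (α g) (f g) (affineSubst (α g⁻¹) (f g⁻¹) P) = P := by
    intro g P
    rw [affineSubst_comp, ← map_mul, ← hf, mul_inv_cancel, map_one, h1, affineSubst_one]
  { toFun := fun g => AlgEquiv.ofAlgHom (affineSubst (α g) (f g)) (affineSubst (α g⁻¹) (f g⁻¹))
      (AlgHom.ext (hinv g)) (AlgHom.ext fun P => by simpa using hinv g⁻¹ P)
    map_one' := AlgEquiv.ext fun P => by
      change affineSubst (α 1) (f 1) P = P
      rw [map_one, h1, affineSubst_one]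
    map_mul' := fun g h => AlgEquiv.ext fun P => by
      change affineSubst (α (g * h)) (f (g * h)) P =
        affineSubst (α g) (f g) (affineSubst (α h) (f h) P)
      rw [affineSubst_comp, ← map_mul, ← hf] }

variable (α : G →* (A ≃ₐ[k] A)) (f : G → A) (hf : ∀ g h, f (g * h) = f g + α g (f h))

theorem cocycleAction_apply (g : G) (P : A[X]) :
    cocycleAction α f hf g P = (P.map (α g : A →+* A)).comp (X + C (f g)) := rfl

theorem cocycleAction_C (g : G) (a : A) : cocycleAction α f hf g (C a) = C (α g a) :=
  affineSubst_C _ _ _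

theorem cocycleAction_X (g : G) : cocycleAction α f hf g X = X + C (f g) :=
  affineSubst_X _ _

theorem natDegree_cocycleAction [IsDomain A] (g : G) (P : A[X]) :
    (cocycleAction α f hf g P).natDegree = P.natDegree := by
  rw [cocycleAction_apply, natDegree_comp, natDegree_X_add_C, mul_one]
  exact natDegree_map_eq_of_injective (α g).injective P

end PolynomialAction

/-! ### Stability of the algebra generated by an orbit -/

section Orbit

variable {k G A : Type*} [CommRing k] [Group G] [CommRing A] [Algebra k A]

theorem adjoin_orbit_stable (α : G →* (A ≃ₐ[k] A)) (c : A) (g : G) {x : A}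
    (hx : x ∈ Algebra.adjoin k (Set.range fun h => α h c)) :
    α g x ∈ Algebra.adjoin k (Set.range fun h => α h c) := by
  have h1 : Algebra.adjoin k (Set.range fun h => α h c) ≤
      (Algebra.adjoin k (Set.range fun h => α h c)).comap (α g : A →ₐ[k] A) := by
    refine Algebra.adjoin_le ?_
    rintro _ ⟨h, rfl⟩
    refine Algebra.subset_adjoin ⟨g * h, ?_⟩
    exact action_mul_apply α g h c
  exact h1 hx

end Orbit

/-! ### Extension of G/H-algebras along a central subgroup of order p -/

section CentralExtension

open Polynomial

variable {p : ℕ} {k G A : Type*} [Field k] [CharP k p] [Group G] {H : Subgroup G}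

variable (k) in
/-- The element of the prime field corresponding to an element of a group of order `p`. -/
def zmodValue (e : H ≃* Multiplicative (ZMod p)) (y : H) : k :=
  ZMod.castHom (dvd_refl p) k (e y).toAdd

theorem zmodValue_mul (e : H ≃* Multiplicative (ZMod p)) (y y' : H) :
    zmodValue k e (y * y') = zmodValue k e y + zmodValue k e y' := by
  simp only [zmodValue, map_mul, toAdd_mul, map_add]

theorem zmodValue_inv (e : H ≃* Multiplicative (ZMod p)) (y : H) :
    zmodValue k e y⁻¹ = -zmodValue k e y := by
  simp only [zmodValue, map_inv, toAdd_inv, map_neg]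

theorem zmodValue_pow [Fact p.Prime] (e : H ≃* Multiplicative (ZMod p)) (y : H) :
    zmodValue k e y ^ p = zmodValue k e y := by
  rw [zmodValue, ← map_pow, ZMod.pow_card]

theorem zmodValue_injective [Fact p.Prime] (e : H ≃* Multiplicative (ZMod p)) :
    Function.Injective (zmodValue k e) := fun _ _ h =>
  e.injective (Multiplicative.toAdd.injective ((ZMod.castHom (dvd_refl p) k).injective h))

theorem sum_zmodValue [Fact p.Prime] [Fintype H] {M : Type*} [AddCommMonoid M]
    (e : H ≃* Multiplicative (ZMod p)) (F : k → M) :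
    ∑ y, F (zmodValue k e y) = ∑ a : ZMod p, F (ZMod.castHom (dvd_refl p) k a) :=
  Fintype.sum_equiv (e.toEquiv.trans Multiplicative.toAdd) _ _ fun _ => rfl

variable (k) in
/-- A function on `G` which is a coordinate on each coset of `H`. -/
def cosetCoord (e : H ≃* Multiplicative (ZMod p)) (x : G) : k :=
  -zmodValue k e ⟨(QuotientGroup.mk x : G ⧸ H).out⁻¹ * x,
    QuotientGroup.eq.1 (QuotientGroup.out_eq' _)⟩

theorem cosetCoord_mul (e : H ≃* Multiplicative (ZMod p)) (x : G) (y : H) :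
    cosetCoord k e (x * y) = cosetCoord k e x - zmodValue k e y := by
  rw [cosetCoord, cosetCoord, ← neg_add', ← zmodValue_mul]
  congr 2
  apply Subtype.ext
  change _ = (QuotientGroup.mk x : G ⧸ H).out⁻¹ * x * y
  have h : (QuotientGroup.mk (x * y) : G ⧸ H) = QuotientGroup.mk x := by simp
  rw [← h, mul_assoc]

/-- Right translation by an element of H shifts both terms by the same constant. -/
theorem cosetCoord_sub_eq (e : H ≃* Multiplicative (ZMod p)) (g : G) {x x' : G}
    (h : (QuotientGroup.mk x : G ⧸ H) = QuotientGroup.mk x') :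
    cosetCoord k e (g * x) - cosetCoord k e x = cosetCoord k e (g * x') - cosetCoord k e x' := by
  obtain ⟨y, rfl⟩ : ∃ y : H, x' = x * y :=
    ⟨⟨x⁻¹ * x', QuotientGroup.eq.1 h⟩, (mul_inv_cancel_left _ _).symm⟩
  rw [← mul_assoc, cosetCoord_mul, cosetCoord_mul]
  ring

variable [CommRing A] [Algebra k A] [H.Normal] [Fintype (G ⧸ H)]

/-- The cocycle of `G` with values in a `G ⧸ H`-algebra with a point `c` of trace one which extends
the isomorphism `e` of the central subgroup `H` with `ℤ/p`. -/
def extensionCocycle (e : H ≃* Multiplicative (ZMod p)) (α : (G ⧸ H) →* (A ≃ₐ[k] A)) (c : A)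
    (g : G) : A :=
  ∑ q : G ⧸ H, (cosetCoord k e (g⁻¹ * q.out) - cosetCoord k e q.out) • α q c

/-- The coboundary of `cosetCoord` takes values in functions on G/H, and F ↦ ∑ F(q) q(c) sends such
functions equivariantly to A. So it carries this coboundary to a cocycle, which need not be a
coboundary in A. -/
theorem extensionCocycle_mul (e : H ≃* Multiplicative (ZMod p)) (α : (G ⧸ H) →* (A ≃ₐ[k] A))
    (c : A) (g h : G) :
    extensionCocycle e α c (g * h) = extensionCocycle e α c g +
      α.comp (QuotientGroup.mk' H) g (extensionCocycle e α c h) := by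
  have h1 : α.comp (QuotientGroup.mk' H) g (extensionCocycle e α c h) = ∑ q : G ⧸ H,
      (cosetCoord k e (h⁻¹ * (g⁻¹ * q.out)) - cosetCoord k e (g⁻¹ * q.out)) • α q c := by
    simp only [extensionCocycle, map_sum, map_smul]
    refine Fintype.sum_equiv (Equiv.mulLeft (QuotientGroup.mk g : G ⧸ H)) _ _ fun q => ?_
    rw [Equiv.coe_mulLeft, action_mul_apply]
    congr 1
    refine cosetCoord_sub_eq e _ ?_
    rw [QuotientGroup.mk_mul, QuotientGroup.out_eq', QuotientGroup.out_eq', QuotientGroup.mk_inv,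
      inv_mul_cancel_left]
  rw [h1, extensionCocycle, extensionCocycle, ← Finset.sum_add_distrib]
  refine Finset.sum_congr rfl fun q _ => ?_
  rw [← add_smul, mul_inv_rev, mul_assoc]
  congr 1
  ring

/-- A central y⁻¹ moves to the right of each representative, where it changes the coordinate by a
constant. The minus sign in `cosetCoord` makes this constant e(y), and the conjugates of c sum to 1.
-/
theorem extensionCocycle_of_mem (e : H ≃* Multiplicative (ZMod p))
    (hH : ∀ y ∈ H, ∀ x, y * x = x * y) (α : (G ⧸ H) →* (A ≃ₐ[k] A)) {c : A}
    (hc : trace α c = 1) (y : H) :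
    extensionCocycle e α c y = algebraMap k A (zmodValue k e y) := by
  have h : ∀ q : G ⧸ H, (cosetCoord k e ((y : G)⁻¹ * q.out) - cosetCoord k e q.out) • α q c =
      zmodValue k e y • α q c := by
    intro q
    have h1 : (y : G)⁻¹ * q.out = q.out * ((y⁻¹ : H) : G) := hH _ (H.inv_mem y.2) _
    rw [h1, cosetCoord_mul, zmodValue_inv]
    congr 1
    ring
  rw [extensionCocycle, Finset.sum_congr rfl fun q _ => h q, ← Finset.smul_sum,
    show ∑ q, α q c = 1 from hc, Algebra.algebraMap_eq_smul_one]

/-- The extension of a `G ⧸ H`-algebra to a `G`-algebra by a variable, for a central subgroup `H`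
of order `p`. -/
def extensionAction (e : H ≃* Multiplicative (ZMod p)) (α : (G ⧸ H) →* (A ≃ₐ[k] A)) (c : A) :
    G →* (A[X] ≃ₐ[k] A[X]) :=
  cocycleAction (α.comp (QuotientGroup.mk' H)) (extensionCocycle e α c)
    (extensionCocycle_mul e α c)

variable (e : H ≃* Multiplicative (ZMod p)) (hH : ∀ y ∈ H, ∀ x, y * x = x * y)
  (α : (G ⧸ H) →* (A ≃ₐ[k] A)) {c : A}

theorem extensionAction_C (g : G) (a : A) :
    extensionAction e α c g (C a) = C (α (QuotientGroup.mk g) a) := cocycleAction_C _ _ _ _ _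

theorem extensionAction_X (g : G) :
    extensionAction e α c g X = X + C (extensionCocycle e α c g) := cocycleAction_X _ _ _ _

include hH in
theorem extensionCocycle_mul_of_mem (hc : trace α c = 1) (g : G) (y : H) :
    extensionCocycle e α c (g * y) =
      extensionCocycle e α c g + algebraMap k A (zmodValue k e y) := by
  rw [extensionCocycle_mul, extensionCocycle_of_mem e hH α hc, AlgEquiv.commutes]

-- Over each coset of H the powers (X + f + a)^{p−1}, with a in the prime field, sum to −1 whatever
-- f is. This leaves the trace of c, and explains the exponent and the sign.
include hH in
theorem trace_extensionAction [Fact p.Prime] [Fintype G] (hc : trace α c = 1) :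
    trace (extensionAction e α c) (-(C c * X ^ (p - 1))) = 1 := by
  classical
  have h1 : ∀ q : G ⧸ H, ∀ y : H, extensionAction e α c (q.out * y) (-(C c * X ^ (p - 1))) =
      -(C (α q c) * (X + C (extensionCocycle e α c q.out) +
        algebraMap k A[X] (zmodValue k e y)) ^ (p - 1)) := by
    intro q y
    have h2 : (QuotientGroup.mk (q.out * (y : G)) : G ⧸ H) = q := by simp
    rw [map_neg, map_mul, map_pow, extensionAction_C, extensionAction_X, h2,
      extensionCocycle_mul_of_mem e hH α hc, map_add, ← add_assoc]
    rfl
  rw [trace, sum_eq_sum_quotient H]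
  simp only [h1, Finset.sum_neg_distrib, ← Finset.mul_sum]
  have h3 : ∀ x : A[X], ∑ y : H, (x + algebraMap k A[X] (zmodValue k e y)) ^ (p - 1) = -1 := by
    intro x
    rw [sum_zmodValue e fun a => (x + algebraMap k A[X] a) ^ (p - 1)]
    exact sum_add_zmod_pow ((algebraMap k A[X]).comp (ZMod.castHom (dvd_refl p) k)) x
  simp only [h3, mul_neg, mul_one, Finset.sum_neg_distrib, neg_neg, ← map_sum]
  rw [show ∑ q, α q c = 1 from hc, map_one]

include hH in
theorem adjoin_orbit_extensionAction [Fact p.Prime] [Nontrivial A] [Finite H]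
    (hc : trace α c = 1) (hgen : Algebra.adjoin k (Set.range fun q => α q c) = ⊤) :
    Algebra.adjoin k
      (Set.range fun g => extensionAction e α c g (-(C c * X ^ (p - 1)))) = ⊤ := by
  have := Fintype.ofFinite H
  have : CharP A[X] p := charP_of_injective_algebraMap (algebraMap k A[X]).injective p
  set S := Algebra.adjoin k
    (Set.range fun g => extensionAction e α c g (-(C c * X ^ (p - 1)))) with hS
  have hstable : ∀ g, ∀ P ∈ S, extensionAction e α c g P ∈ S := fun g P hP =>
    adjoin_orbit_stable _ _ g hP
  have horb : ∀ y : H, C c * (X + algebraMap k A[X] (zmodValue k e y)) ^ (p - 1) ∈ S := by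
    intro y
    have h1 : extensionAction e α c y (-(C c * X ^ (p - 1))) ∈ S :=
      Algebra.subset_adjoin ⟨y, rfl⟩
    have h2 : (QuotientGroup.mk (y : G) : G ⧸ H) = 1 := (QuotientGroup.eq_one_iff _).2 y.2
    rw [map_neg, map_mul, map_pow, extensionAction_C, extensionAction_X, h2,
      extensionCocycle_of_mem e hH α hc, action_one_apply] at h1
    simpa using S.neg_mem h1
  let ι : ZMod p →+* A[X] := (algebraMap k A[X]).comp (ZMod.castHom (dvd_refl p) k)
  -- The H-orbit consists of the elements −c(X + a)^{p−1}. Their plain sum recovers c, and their sum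
  -- weighted by a recovers c X below.
  have hc0 : C c ∈ S := by
    have h1 := S.sum_mem fun y (_ : y ∈ Finset.univ) => horb y
    rw [← Finset.mul_sum, sum_zmodValue e fun a => (X + algebraMap k A[X] a) ^ (p - 1)] at h1
    have h2 := sum_add_zmod_pow ι (X : A[X])
    simp only [ι, RingHom.comp_apply] at h2
    rw [h2] at h1
    simpa using S.neg_mem h1
  have hC : ∀ a, C a ∈ S := by
    intro a
    have h1 : Algebra.adjoin k (Set.range fun q => α q c) ≤ S.comap CAlgHom := by
      refine Algebra.adjoin_le ?_
      rintro _ ⟨q, rfl⟩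
      obtain ⟨g, rfl⟩ := QuotientGroup.mk_surjective q
      change C (α (QuotientGroup.mk g) c) ∈ S
      rw [← extensionAction_C e α (c := c)]
      exact hstable g _ hc0
    rw [hgen] at h1
    exact h1 (show a ∈ ⊤ from trivial)
  have hcX : C c * X ∈ S := by
    have h1 := S.sum_mem fun y (_ : y ∈ Finset.univ) => S.smul_mem (horb y) (zmodValue k e y)
    simp only [Algebra.smul_def, mul_left_comm _ (C c)] at h1
    rw [← Finset.mul_sum, sum_zmodValue e fun a =>
      algebraMap k A[X] a * (X + algebraMap k A[X] a) ^ (p - 1)] at h1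
    have h2 := sum_zmod_mul_add_pow ι (X : A[X])
    simp only [ι, RingHom.comp_apply] at h2
    rw [h2, mul_add] at h1
    have h3 := S.mul_mem hc0
      (S.algebraMap_mem (ZMod.castHom (dvd_refl p) k (∑ a : ZMod p, a)))
    simpa using S.sub_mem h1 h3
  -- The translates of c X are g(c) X up to elements of A, and the sum over G/H is X because tr c =
  -- 1.
  have hX : X ∈ S := by
    have h1 : ∀ q : G ⧸ H, C (α q c) * X ∈ S := by
      intro q
      obtain ⟨g, rfl⟩ := QuotientGroup.mk_surjective q
      have h2 := hstable g _ hcX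
      rw [map_mul, extensionAction_C, extensionAction_X, mul_add] at h2
      simpa using S.sub_mem h2
        (S.mul_mem (hC (α (QuotientGroup.mk g) c)) (hC (extensionCocycle e α c g)))
    have h2 := S.sum_mem fun q (_ : q ∈ Finset.univ) => h1 q
    rw [← Finset.sum_mul, ← map_sum, show ∑ q, α q c = 1 from hc, map_one, one_mul] at h2
    exact h2
  rw [eq_top_iff]
  rintro P -
  induction P using Polynomial.induction_on' with
  | add P Q hP hQ => exact S.add_mem hP hQ
  | monomial n a =>
    rw [← C_mul_X_pow_eq_monomial]
    exact S.mul_mem (hC a) (S.pow_mem hX n)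

include hH in
/-- The twisted Artin–Schreier polynomial `X ^ p - X + b` is invariant for a suitable `b`. -/
theorem exists_invariant_artinSchreier [Fact p.Prime] [Nontrivial A] (hc : trace α c = 1) :
    ∃ b : A, X ^ p - X + C b ∈ invariants (extensionAction e α c) := by
  have : CharP A p := charP_of_injective_algebraMap (algebraMap k A).injective p
  have : CharP A[X] p := charP_of_injective_algebraMap (algebraMap k A[X]).injective p
  let f := extensionCocycle e α c
  -- The Artin–Schreier map kills the prime field, so this cocycle descends to G/H. There a point
  -- makes it a coboundary, with b as the primitive.
  let d : G → A := fun g => f g ^ p - f g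
  have hd : ∀ g h, d (g * h) = d g + α (QuotientGroup.mk g) (d h) := by
    intro g h
    have h1 : f (g * h) = f g + α (QuotientGroup.mk g) (f h) := extensionCocycle_mul e α c g h
    simp only [d, h1, add_pow_char, map_sub, map_pow]
    ring
  have hdH : ∀ g (y : H), d (g * y) = d g := by
    intro g y
    have h1 : f (g * y) = f g + algebraMap k A (zmodValue k e y) :=
      extensionCocycle_mul_of_mem e hH α hc g y
    simp only [d, h1, add_pow_char, ← map_pow, zmodValue_pow]
    ring
  have hdq : ∀ {x x' : G}, (QuotientGroup.mk x : G ⧸ H) = QuotientGroup.mk x' → d x = d x' := by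
    intro x x' h
    have h1 := hdH x ⟨x⁻¹ * x', QuotientGroup.eq.1 h⟩
    rw [← h1]
    exact congrArg d (mul_inv_cancel_left x x')
  let b : A := ∑ q : G ⧸ H, d q.out * α q c
  have hb : ∀ g : G, α (QuotientGroup.mk g) b = b - d g := by
    intro g
    have h1 : ∀ q : G ⧸ H, α (QuotientGroup.mk g) (d q.out * α q c) =
        (d ((QuotientGroup.mk g : G ⧸ H) * q).out - d g) * α (QuotientGroup.mk g * q) c := by
      intro q
      have h2 : d ((QuotientGroup.mk g : G ⧸ H) * q).out = d (g * q.out) := by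
        refine hdq ?_
        rw [QuotientGroup.out_eq', QuotientGroup.mk_mul, QuotientGroup.out_eq']
      rw [h2, hd, add_sub_cancel_left, map_mul, action_mul_apply]
    have h3 : α (QuotientGroup.mk g) b = ∑ q : G ⧸ H, (d q.out - d g) * α q c := by
      rw [map_sum, Finset.sum_congr rfl fun q _ => h1 q]
      exact Equiv.sum_comp (Equiv.mulLeft (QuotientGroup.mk g : G ⧸ H))
        fun q => (d q.out - d g) * α q c
    rw [h3]
    simp only [sub_mul, Finset.sum_sub_distrib, ← Finset.mul_sum]
    rw [show ∑ q, α q c = 1 from hc, mul_one]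
  refine ⟨b, fun g => ?_⟩
  rw [map_add, map_sub, map_pow, extensionAction_X, extensionAction_C, hb, add_pow_char, map_sub]
  simp only [d, map_sub, map_pow, f]
  ring

-- Invariance under H gives R(a) = R(0) for all a in the prime field, so R − R(0) has more roots
-- than its degree allows.
include hH in
theorem exists_eq_C_of_mem_invariants [Fact p.Prime] [IsDomain A] (hc : trace α c = 1)
    {R : A[X]} (hR : R ∈ invariants (extensionAction e α c)) (hdeg : R.natDegree < p) :
    ∃ r ∈ invariants α, R = C r := by
  have := Fintype.ofEquiv _ (e.toEquiv.trans Multiplicative.toAdd).symm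
  have hcard : Fintype.card H = p := by
    rw [Fintype.card_congr (e.toEquiv.trans Multiplicative.toAdd), ZMod.card]
  have hinj : Function.Injective fun y : H => algebraMap k A (zmodValue k e y) :=
    (algebraMap k A).injective.comp (zmodValue_injective e)
  have heval : ∀ y : H, R.eval (algebraMap k A (zmodValue k e y)) = R.eval 0 := by
    intro y
    have h1 : (extensionAction e α c y R).eval 0 = R.eval 0 := by rw [hR]
    have h2 : α.comp (QuotientGroup.mk' H) (y : G) = 1 := by
      rw [MonoidHom.comp_apply, QuotientGroup.mk'_apply, (QuotientGroup.eq_one_iff _).2 y.2,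
        map_one]
    have h3 : R.map ((1 : A ≃ₐ[k] A) : A →+* A) = R := Polynomial.map_id
    rw [extensionAction, cocycleAction_apply, extensionCocycle_of_mem e hH α hc, h2, h3,
      eval_comp] at h1
    simpa using h1
  have h0 : R - C (R.eval 0) = 0 := by
    refine eq_zero_of_natDegree_lt_card_of_eval_eq_zero _ hinj (fun y => ?_) ?_
    · rw [eval_sub, heval, eval_C, sub_self]
    · rwa [natDegree_sub_C, hcard]
  have hRC : R = C (R.eval 0) := sub_eq_zero.1 h0
  refine ⟨R.eval 0, fun q => ?_, hRC⟩
  obtain ⟨g, rfl⟩ := QuotientGroup.mk_surjective q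
  apply C_injective
  rw [← extensionAction_C e α (c := c), ← hRC, hR]

include hH in
/-- The invariants of the extension form a polynomial ring over the invariants. -/
theorem nonempty_invariants_extensionAction_equiv [Fact p.Prime] [IsDomain A]
    (hc : trace α c = 1) :
    Nonempty ((invariants α)[X] ≃ₐ[k] invariants (extensionAction e α c)) := by
  have hp : 1 < p := (Fact.out : p.Prime).one_lt
  obtain ⟨b, hb⟩ := exists_invariant_artinSchreier e hH α hc
  set W : A[X] := X ^ p - X + C b with hW
  have hWd : (-X + C b : A[X]).degree < p := by
    refine lt_of_le_of_lt (degree_add_le _ _) (max_lt ?_ ?_)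
    · rw [degree_neg, degree_X]
      exact_mod_cast hp
    · exact lt_of_le_of_lt degree_C_le (by exact_mod_cast (zero_lt_one.trans hp))
  have hW' : W = X ^ p + (-X + C b) := by rw [hW]; ring
  have hmonic : W.Monic := hW' ▸ monic_X_pow_add hWd
  have hWn : W.natDegree = p := by
    refine natDegree_eq_of_degree_eq_some ?_
    rw [hW', degree_add_eq_left_of_degree_lt (by rwa [degree_X_pow]), degree_X_pow]
  let F : (invariants α)[X] →ₐ[k] A[X] :=
    ((aeval W : A[X] →ₐ[A] A[X]).restrictScalars k).comp (mapAlgHom (invariants α).val)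
  have hF : ∀ Q, F Q = (Q.map (algebraMap (invariants α) A)).comp W := fun Q => rfl
  have hFC : ∀ r : invariants α, F (C r) = C (r : A) := by
    intro r
    rw [hF, map_C, C_comp]
    rfl
  have hFX : F X = W := by rw [hF, map_X, X_comp]
  have hmem : ∀ Q, F Q ∈ invariants (extensionAction e α c) := by
    intro Q
    induction Q using Polynomial.induction_on' with
    | add P Q hP hQ => rw [map_add]; exact add_mem hP hQ
    | monomial n r =>
      rw [← C_mul_X_pow_eq_monomial, map_mul, map_pow, hFX, hFC]
      refine mul_mem (fun g => ?_) (pow_mem hb n)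
      rw [extensionAction_C, r.2]
  have hinj : Function.Injective (F.codRestrict _ hmem) := by
    rw [AlgHom.injective_codRestrict, injective_iff_map_eq_zero]
    intro Q hQ
    rw [hF, comp_eq_zero_iff] at hQ
    rcases hQ with hQ | ⟨-, hQ⟩
    · exact (Polynomial.map_eq_zero_iff Subtype.val_injective).1 hQ
    · have := congrArg natDegree hQ
      rw [natDegree_C, hWn] at this
      omega
  have key : ∀ N : ℕ, ∀ P ∈ invariants (extensionAction e α c), P.natDegree < N → P ∈ F.range := by
    intro N
    induction N with
    | zero => intro P _ h; omega
    | succ N ih =>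
      intro P hP hPN
      by_cases hlt : P.natDegree < p
      · obtain ⟨r, hr, rfl⟩ := exists_eq_C_of_mem_invariants e hH α hc hP hlt
        exact ⟨C ⟨r, hr⟩, hFC _⟩
      -- W is monic and invariant and G preserves degrees, so uniqueness of division makes quotient
      -- and remainder invariant. The remainder is then constant, and the quotient has smaller
      -- degree.
      · have huniq : ∀ g, P /ₘ W = extensionAction e α c g (P /ₘ W) ∧
            P %ₘ W = extensionAction e α c g (P %ₘ W) := by
          intro g
          refine div_modByMonic_unique _ _ hmonic ⟨?_, ?_⟩
          · have h1 := congrArg (extensionAction e α c g) (modByMonic_add_div P W)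
            rwa [map_add, map_mul, hb g, hP g] at h1
          · refine degree_lt_degree ?_
            rw [extensionAction, natDegree_cocycleAction]
            refine natDegree_modByMonic_lt P hmonic fun h => ?_
            rw [h, natDegree_one] at hWn
            omega
        have hR : P %ₘ W ∈ invariants (extensionAction e α c) := fun g => (huniq g).2.symm
        have hQ : P /ₘ W ∈ invariants (extensionAction e α c) := fun g => (huniq g).1.symm
        have hRd : (P %ₘ W).natDegree < p := by
          conv_rhs => rw [← hWn]
          refine natDegree_modByMonic_lt P hmonic fun h => ?_
          rw [h, natDegree_one] at hWn
          omega
        obtain ⟨r, hr, hRr⟩ := exists_eq_C_of_mem_invariants e hH α hc hR hRd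
        have hQF := ih _ hQ (by rw [natDegree_divByMonic P hmonic, hWn]; omega)
        rw [← modByMonic_add_div P W, hRr]
        exact add_mem ⟨C ⟨r, hr⟩, hFC _⟩ (mul_mem ⟨X, hFX⟩ hQF)
  refine ⟨AlgEquiv.ofBijective (F.codRestrict _ hmem) ⟨hinj, fun P => ?_⟩⟩
  obtain ⟨Q, hQ⟩ := key _ P P.2 (Nat.lt_succ_self _)
  exact ⟨Q, Subtype.ext hQ⟩

end CentralExtension

/-! ### Central subgroups of order p -/

section CentralSubgroup

theorem exists_central_subgroup {p n : ℕ} [Fact p.Prime] {G : Type*} [Group G] [Fintype G]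
    (hG : Fintype.card G = p ^ (n + 1)) :
    ∃ H : Subgroup G, (∀ y ∈ H, ∀ x, y * x = x * y) ∧
      Nonempty (H ≃* Multiplicative (ZMod p)) ∧ Nat.card (G ⧸ H) = p ^ n := by
  have hp : p.Prime := Fact.out
  have hGc : Nat.card G = p ^ (n + 1) := by rw [Nat.card_eq_fintype_card, hG]
  have hpG : IsPGroup p G := IsPGroup.of_card hGc
  have hnt : Nontrivial G := by
    rw [← Finite.one_lt_card_iff_nontrivial, hGc]
    exact Nat.one_lt_pow n.succ_ne_zero hp.one_lt
  have hc := hpG.center_nontrivial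
  have hdvd : p ∣ Nat.card (Subgroup.center G) := by
    obtain ⟨m, hm⟩ := IsPGroup.iff_card.1 (hpG.to_subgroup (Subgroup.center G))
    rw [hm]
    refine dvd_pow_self p fun h => ?_
    rw [h, pow_zero] at hm
    exact absurd hm (Finite.one_lt_card (α := Subgroup.center G)).ne'
  obtain ⟨z, hz⟩ := exists_prime_orderOf_dvd_card' p hdvd
  have hH : Nat.card (Subgroup.zpowers (z : G)) = p := by
    rw [Nat.card_zpowers, Subgroup.orderOf_coe, hz]
  refine ⟨Subgroup.zpowers (z : G), ?_, ⟨mulEquivOfPrimeCardEq (p := p) hH (by simp)⟩, ?_⟩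
  · intro y hy x
    have h1 : Subgroup.zpowers (z : G) ≤ Subgroup.center G :=
      (Subgroup.zpowers_le).2 z.2
    exact (Subgroup.mem_center_iff.1 (h1 hy) x).symm
  · have h1 := Subgroup.card_eq_card_quotient_mul_card_subgroup (Subgroup.zpowers (z : G))
    rw [hH, hGc, pow_succ] at h1
    exact (Nat.eq_of_mul_eq_mul_right hp.pos h1).symm

theorem normal_of_central {G : Type*} [Group G] {H : Subgroup G}
    (hH : ∀ y ∈ H, ∀ x, y * x = x * y) : H.Normal :=
  ⟨fun y hy x => by rwa [← hH y hy x, mul_inv_cancel_right]⟩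

end CentralSubgroup

/-! ### Adding a last variable -/

section PolynomialVariables

open Polynomial

variable {k A : Type*} [CommRing k] [CommRing A] [Algebra k A] {n : ℕ}

/-- Adding a last variable to a polynomial ring. -/
def polynomialVariablesEquiv (e : MvPolynomial (Fin n) k ≃ₐ[k] A) :
    MvPolynomial (Fin (n + 1)) k ≃ₐ[k] A[X] :=
  (MvPolynomial.renameEquiv k finSuccEquivLast).trans
    ((MvPolynomial.optionEquivLeft k (Fin n)).trans (Polynomial.mapAlgEquiv e))

theorem polynomialVariablesEquiv_last (e : MvPolynomial (Fin n) k ≃ₐ[k] A) :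
    polynomialVariablesEquiv e (MvPolynomial.X (Fin.last n)) = X := by
  simp [polynomialVariablesEquiv, MvPolynomial.optionEquivLeft_X_none]

theorem polynomialVariablesEquiv_castSucc (e : MvPolynomial (Fin n) k ≃ₐ[k] A) (i : Fin n) :
    polynomialVariablesEquiv e (MvPolynomial.X i.castSucc) = C (e (MvPolynomial.X i)) := by
  simp [polynomialVariablesEquiv, MvPolynomial.optionEquivLeft_X_some]

/-- Adding a variable to a triangular polynomial algebra. -/
theorem IsTriangularPolynomial.cocycleAction {G : Type*} [Group G] {α : G →* (A ≃ₐ[k] A)}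
    (hα : IsTriangularPolynomial n α) (f : G → A)
    (hf : ∀ g h, f (g * h) = f g + α g (f h)) :
    IsTriangularPolynomial (n + 1) (cocycleAction α f hf) := by
  obtain ⟨e, he⟩ := hα
  refine ⟨polynomialVariablesEquiv e, fun g i => ?_⟩
  have hC : ∀ (s : Set (Fin n)) (i : Fin (n + 1)), (∀ j ∈ s, j.castSucc < i) →
      ∀ a ∈ Algebra.adjoin k ((fun j => e (MvPolynomial.X j)) '' s), C a ∈
        Algebra.adjoin k
          ((fun j => polynomialVariablesEquiv e (MvPolynomial.X j)) '' {j | j < i}) := by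
    intro s i hs a ha
    have h1 : Algebra.adjoin k ((fun j => e (MvPolynomial.X j)) '' s) ≤
        (Algebra.adjoin k ((fun j => polynomialVariablesEquiv e (MvPolynomial.X j)) ''
          {j | j < i})).comap CAlgHom := by
      refine Algebra.adjoin_le ?_
      rintro _ ⟨j, hj, rfl⟩
      exact Algebra.subset_adjoin ⟨j.castSucc, hs j hj, polynomialVariablesEquiv_castSucc e j⟩
    exact h1 ha
  refine Fin.lastCases ?_ (fun i => ?_) i
  · rw [polynomialVariablesEquiv_last, cocycleAction_X, add_sub_cancel_left]
    refine hC Set.univ _ (fun j _ => Fin.castSucc_lt_last j) _ ?_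
    have htop : Algebra.adjoin k ((fun j => e (MvPolynomial.X j)) '' Set.univ) = ⊤ := by
      have h1 := AlgHom.map_adjoin (e : MvPolynomial (Fin n) k →ₐ[k] A) (Set.range MvPolynomial.X)
      rw [MvPolynomial.adjoin_range_X, Algebra.map_top, (AlgHom.range_eq_top _).2 e.surjective,
        ← Set.range_comp] at h1
      rw [Set.image_univ, h1]
      rfl
    rw [htop]
    trivial
  · rw [polynomialVariablesEquiv_castSucc, cocycleAction_C, ← C_sub]
    exact hC {j | j < i} _ (fun j hj => Fin.castSucc_lt_castSucc_iff.2 hj) _ (he g i)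

end PolynomialVariables

/-! ### An algebra in n variables generated by the orbit of a point -/

section BasicAlgebra

open Polynomial

/-- Every `p`-group of order `p ^ n` acts on a polynomial ring in `n` variables over a field of
characteristic `p`, triangularly, with polynomial ring of invariants, and such that the orbit of
some point of trace one generates. -/
theorem exists_basic_algebra (p : ℕ) [Fact p.Prime] (k : Type u) [Field k] [CharP k p] (n : ℕ) :
    ∀ (G : Type v) [Group G] [Fintype G], Fintype.card G = p ^ n →
      ∃ (A : Type u) (_ : CommRing A) (_ : Algebra k A) (α : G →* (A ≃ₐ[k] A)) (c : A),
        IsTriangularPolynomial n α ∧ trace α c = 1 ∧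
        Algebra.adjoin k (Set.range fun g => α g c) = ⊤ ∧
        Nonempty (invariants α ≃ₐ[k] MvPolynomial (Fin n) k) := by
  induction n with
  | zero =>
    intro G _ _ hG
    refine ⟨MvPolynomial (Fin 0) k, inferInstance, inferInstance, 1, 1,
      ⟨AlgEquiv.refl, fun g i => i.elim0⟩, ?_, ?_, ?_⟩
    · simp only [trace, map_one, Finset.sum_const, Finset.card_univ, hG, pow_zero, one_smul]
    · rw [eq_top_iff, ← MvPolynomial.adjoin_range_X]
      refine Algebra.adjoin_le ?_
      rintro _ ⟨i, rfl⟩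
      exact i.elim0
    · have h : invariants (1 : G →* (MvPolynomial (Fin 0) k ≃ₐ[k] _)) = ⊤ :=
        eq_top_iff.2 fun x _ g => rfl
      exact ⟨(Subalgebra.equivOfEq _ _ h).trans Subalgebra.topEquiv⟩
  | succ n ih =>
    intro G _ _ hG
    obtain ⟨H, hH, ⟨e⟩, hcard⟩ := exists_central_subgroup hG
    have := normal_of_central hH
    have := Fintype.ofFinite (G ⧸ H)
    rw [Nat.card_eq_fintype_card] at hcard
    obtain ⟨A, _, _, α, c, hα, hc, hgen, ⟨i⟩⟩ := ih (G ⧸ H) hcard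
    have hdom : IsDomain A := by
      obtain ⟨e, -⟩ := hα
      exact e.symm.toMulEquiv.isDomain _
    obtain ⟨j⟩ := nonempty_invariants_extensionAction_equiv e hH α hc
    refine ⟨A[X], inferInstance, inferInstance, extensionAction e α c, -(C c * X ^ (p - 1)), ?_,
      trace_extensionAction e hH α hc, adjoin_orbit_extensionAction e hH α hc hgen, ?_⟩
    · refine IsTriangularPolynomial.cocycleAction ?_ _ _
      obtain ⟨e, he⟩ := hα
      exact ⟨e, fun g i => he _ i⟩
    · exact ⟨j.symm.trans ((Polynomial.mapAlgEquiv i).trans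
        (polynomialVariablesEquiv AlgEquiv.refl).symm)⟩

end BasicAlgebra

/-! ### Triangular bases for representations of p-groups -/

section Flags

variable {p : ℕ} [Fact p.Prime] {k G V : Type*} [Field k] [CharP k p] [Group G] [Finite G]
  [AddCommGroup V] [Module k V]

/-- A `p`-group acting linearly on a nonzero space in characteristic `p` fixes a nonzero vector. -/
theorem exists_fixed_vector (hG : IsPGroup p G) [Nontrivial V] (ρ : G →* (V →ₗ[k] V)) :
    ∃ v ≠ 0, ∀ g, ρ g v = v := by
  obtain ⟨u, hu⟩ := exists_ne (0 : V)
  -- Over the prime field the orbit of u spans a finite stable group of p-power order even when k is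
  -- infinite. Since 0 is fixed there, counting modulo p yields another fixed point.
  let _ : Module (ZMod p) V := Module.compHom V (ZMod.castHom (dvd_refl p) k)
  have hlin : ∀ (g : G) (a : ZMod p) (x : V), ρ g (a • x) = a • ρ g x := fun g a x =>
    (ρ g).map_smul (ZMod.castHom (dvd_refl p) k a) x
  let M : Submodule (ZMod p) V := Submodule.span (ZMod p) (Set.range fun g => ρ g u)
  have hM : ∀ g, ∀ x ∈ M, ρ g x ∈ M := by
    intro g x hx
    induction hx using Submodule.span_induction with
    | mem x hx =>
      obtain ⟨h, rfl⟩ := hx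
      refine Submodule.subset_span ⟨g * h, ?_⟩
      simp only [map_mul, Module.End.mul_apply]
    | zero => rw [map_zero]; exact M.zero_mem
    | add x y _ _ hx hy => rw [map_add]; exact M.add_mem hx hy
    | smul a x _ hx => rw [hlin]; exact M.smul_mem a hx
  have : Module.Finite (ZMod p) M :=
    Module.Finite.span_of_finite (ZMod p) (Set.finite_range fun g => ρ g u)
  have : Finite M := Module.finite_of_finite (ZMod p)
  have huM : u ∈ M := Submodule.subset_span ⟨1, by simp⟩
  have : Nontrivial M := ⟨⟨⟨u, huM⟩, 0, fun h => hu (congrArg Subtype.val h)⟩⟩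
  let _ : MulAction G M :=
    { smul := fun g x => ⟨ρ g x, hM g x x.2⟩
      one_smul := fun x => Subtype.ext (by change ρ 1 (x : V) = x; simp)
      mul_smul := fun g h x => Subtype.ext (by change ρ (g * h) (x : V) = ρ g (ρ h x); simp) }
  have hcard : p ∣ Nat.card M := by
    rw [Module.natCard_eq_pow_finrank (K := ZMod p), Nat.card_zmod]
    exact dvd_pow_self p (Module.finrank_pos (R := ZMod p) (M := M)).ne'
  have h0 : (0 : M) ∈ MulAction.fixedPoints G M := fun g => Subtype.ext (map_zero (ρ g))
  obtain ⟨b, hb, hne⟩ := hG.exists_fixed_point_of_prime_dvd_card_of_fixed_point M hcard h0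
  exact ⟨b, fun h => hne (Subtype.ext h.symm), fun g => congrArg Subtype.val (hb g)⟩

/-- A stable subspace of a representation of a `p`-group in characteristic `p` has a triangular
complementary basis. -/
theorem exists_triangular_complement (hG : IsPGroup p G) [Module.Finite k V]
    (ρ : G →* (V →ₗ[k] V)) (m : ℕ) (W : Submodule k V) (hW : ∀ g, ∀ x ∈ W, ρ g x ∈ W)
    (hm : Module.finrank k W + m = Module.finrank k V) :
    ∃ v : Fin m → V, (∀ g i, ρ g (v i) - v i ∈ W ⊔ Submodule.span k (v '' {j | j < i})) ∧
      W ⊔ Submodule.span k (Set.range v) = ⊤ := by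
  induction m generalizing W with
  | zero =>
    refine ⟨Fin.elim0, fun g i => i.elim0, ?_⟩
    rw [Submodule.eq_top_of_finrank_eq hm, top_sup_eq]
  | succ m ih =>
    have hWtop : W ≠ ⊤ := by
      rintro rfl
      rw [finrank_top] at hm
      omega
    have : Nontrivial (V ⧸ W) := Submodule.Quotient.nontrivial_iff.2 hWtop
    let ρ' : G →* ((V ⧸ W) →ₗ[k] (V ⧸ W)) :=
      { toFun := fun g => W.mapQ W (ρ g) (hW g)
        map_one' := by
          ext x
          simp
        map_mul' := fun g h => by
          ext x
          simp }
    -- A lift of a fixed vector of V/W is fixed modulo W, so it can be the first basis vector; the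
    -- rest come from the enlarged subspace.
    obtain ⟨x, hx, hfix⟩ := exists_fixed_vector hG ρ'
    obtain ⟨v₀, rfl⟩ := W.mkQ_surjective x
    have hv₀ : v₀ ∉ W := fun h => hx ((Submodule.Quotient.mk_eq_zero W).2 h)
    have hv₀W : ∀ g, ρ g v₀ - v₀ ∈ W := fun g => (Submodule.Quotient.eq W).1 (hfix g)
    have hW' : ∀ g, ∀ x ∈ W ⊔ Submodule.span k {v₀}, ρ g x ∈ W ⊔ Submodule.span k {v₀} := by
      intro g
      change W ⊔ Submodule.span k {v₀} ≤ (W ⊔ Submodule.span k {v₀}).comap (ρ g)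
      refine sup_le (fun x hx => Submodule.mem_sup_left (hW g x hx)) ?_
      rw [Submodule.span_singleton_le_iff_mem, Submodule.mem_comap,
        ← sub_add_cancel (ρ g v₀) v₀]
      exact add_mem (Submodule.mem_sup_left (hv₀W g))
        (Submodule.mem_sup_right (Submodule.mem_span_singleton_self v₀))
    obtain ⟨v, hv, hvtop⟩ := ih (W ⊔ Submodule.span k {v₀}) hW' (by
      rw [Submodule.finrank_sup_span_singleton hv₀]
      omega)
    refine ⟨Fin.cons v₀ v, fun g i => ?_, ?_⟩
    · refine Fin.cases ?_ (fun i => ?_) i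
      · exact Submodule.mem_sup_left (hv₀W g)
      · have hle : (W ⊔ Submodule.span k {v₀}) ⊔ Submodule.span k (v '' {j | j < i}) ≤
            W ⊔ Submodule.span k
              ((Fin.cons v₀ v : Fin (m + 1) → V) '' {j | j < i.succ}) := by
          refine sup_le (sup_le le_sup_left ?_) ?_
          · rw [Submodule.span_singleton_le_iff_mem]
            exact Submodule.mem_sup_right (Submodule.subset_span ⟨0, Fin.succ_pos i, rfl⟩)
          · refine le_trans (Submodule.span_mono ?_) le_sup_right
            rintro _ ⟨j, hj, rfl⟩
            exact ⟨j.succ, Fin.succ_lt_succ_iff.2 hj, rfl⟩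
        exact hle (hv g i)
    · rw [Fin.range_cons, Set.insert_eq, Submodule.span_union, ← sup_assoc, hvtop]

end Flags

/-! ### The algebra D_k, its universal property and its linear forms -/

section DkBasics

variable {k G : Type*} [CommRing k] [Group G] [Fintype G]

variable (k) in
/-- The coordinate functions on `D_k`. -/
def dkVar (x : G) : Dk k G := Ideal.Quotient.mk _ (MvPolynomial.X x)

omit [Group G] in
variable (k G) in
theorem sum_dkVar : ∑ x : G, dkVar k x = 1 := by
  have h : (∑ x : G, MvPolynomial.X x) - 1 ∈ dehomIdeal k G :=
    Ideal.subset_span (Set.mem_singleton _)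
  have h1 := Ideal.Quotient.eq.2 h
  rw [map_sum, map_one] at h1
  exact h1

theorem DkAction_dkVar (g x : G) : DkAction k G g (dkVar k x) = dkVar k (g * x) := by
  change Ideal.quotientEquivAlg _ _ _ _ (Ideal.Quotient.mk _ _) = _
  rw [Ideal.quotientEquivAlg_mk]
  congr 1
  simp [symRegAction]

omit [Group G] in
variable (k G) in
theorem adjoin_range_dkVar : Algebra.adjoin k (Set.range (dkVar k : G → Dk k G)) = ⊤ := by
  have h1 := AlgHom.map_adjoin (Ideal.Quotient.mkₐ k (dehomIdeal k G))
    (Set.range MvPolynomial.X)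
  rw [MvPolynomial.adjoin_range_X, Algebra.map_top,
    (AlgHom.range_eq_top _).2 (Ideal.Quotient.mkₐ_surjective k _), ← Set.range_comp] at h1
  exact h1.symm

omit [Group G] in
theorem dk_algHom_ext {B : Type*} [Semiring B] [Algebra k B] {f f' : Dk k G →ₐ[k] B}
    (h : ∀ x, f (dkVar k x) = f' (dkVar k x)) : f = f' :=
  AlgHom.ext_of_adjoin_eq_top (adjoin_range_dkVar k G) (by rintro _ ⟨x, rfl⟩; exact h x)

/-- A family of elements with sum one defines a homomorphism from `D_k`. -/
def dkLift {B : Type*} [CommRing B] [Algebra k B] (b : G → B) (hb : ∑ x, b x = 1) :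
    Dk k G →ₐ[k] B :=
  Ideal.Quotient.liftₐ (dehomIdeal k G) (MvPolynomial.aeval b) (by
    intro P hP
    have h : dehomIdeal k G ≤ RingHom.ker (MvPolynomial.aeval b : MvPolynomial G k →ₐ[k] B) := by
      rw [dehomIdeal, Ideal.span_singleton_le_iff_mem, RingHom.mem_ker]
      simp [hb]
    exact h hP)

omit [Group G] in
theorem dkLift_dkVar {B : Type*} [CommRing B] [Algebra k B] (b : G → B) (hb : ∑ x, b x = 1)
    (x : G) : dkLift (k := k) b hb (dkVar k x) = b x := by
  change MvPolynomial.aeval b (MvPolynomial.X x) = b x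
  rw [MvPolynomial.aeval_X]

theorem trace_dkVar_one : trace (DkAction k G) (dkVar k 1) = 1 := by
  simp only [trace, DkAction_dkVar, mul_one, sum_dkVar]

theorem isTs_DkAction : IsTs (DkAction k G) :=
  ⟨inferInstance, (isTraceSurjective_iff _).2 ⟨_, trace_dkVar_one⟩⟩

/-- A point of trace one defines a morphism from `D_k`. -/
theorem exists_equivariant_of_point {B : Type*} [CommRing B] [Algebra k B]
    (β : G →* (B ≃ₐ[k] B)) {c : B} (hc : trace β c = 1) :
    ∃ f : Dk k G →ₐ[k] B, IsEquivariant (DkAction k G) β f ∧ ∀ x, f (dkVar k x) = β x c := by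
  have hb : ∑ x, β x c = 1 := hc
  refine ⟨dkLift (fun x => β x c) hb, fun g P => ?_, fun x => dkLift_dkVar _ _ x⟩
  have : (dkLift (k := k) (fun x => β x c) hb).comp (DkAction k G g : Dk k G →ₐ[k] Dk k G) =
      (β g : B →ₐ[k] B).comp (dkLift (fun x => β x c) hb) := by
    refine dk_algHom_ext fun x => ?_
    change dkLift _ hb (DkAction k G g (dkVar k x)) = β g (dkLift _ hb (dkVar k x))
    rw [DkAction_dkVar, dkLift_dkVar, dkLift_dkVar, action_mul_apply]
  exact DFunLike.congr_fun this P

variable (k G) in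
/-- `D_k` is a polynomial ring in `|G| - 1` variables. -/
theorem nonempty_dk_equiv : Nonempty (Dk k G ≃ₐ[k] MvPolynomial (Fin (Fintype.card G - 1)) k) := by
  classical
  let b : G → MvPolynomial {x : G // x ≠ 1} k := fun x =>
    if h : x ≠ 1 then MvPolynomial.X ⟨x, h⟩ else 1 - ∑ y, MvPolynomial.X y
  have hb1 : b 1 = 1 - ∑ y, MvPolynomial.X y := by simp [b]
  have hb2 : ∀ y : {x : G // x ≠ 1}, b y = MvPolynomial.X y := fun y => dif_pos y.2
  have hb : ∑ x, b x = 1 := by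
    rw [Fintype.sum_eq_add_sum_subtype_ne b 1, hb1]
    simp only [hb2, sub_add_cancel]
  let F : MvPolynomial {x : G // x ≠ 1} k →ₐ[k] Dk k G := MvPolynomial.aeval fun y => dkVar k y.1
  have hF : ∀ y, F (MvPolynomial.X y) = dkVar k y.1 := fun y => MvPolynomial.aeval_X _ _
  have e : Dk k G ≃ₐ[k] MvPolynomial {x : G // x ≠ 1} k := by
    refine AlgEquiv.ofAlgHom (dkLift b hb) F (MvPolynomial.algHom_ext fun y => ?_)
      (dk_algHom_ext fun x => ?_)
    · rw [AlgHom.comp_apply, hF, dkLift_dkVar, hb2, AlgHom.id_apply]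
    · rw [AlgHom.comp_apply, dkLift_dkVar, AlgHom.id_apply]
      by_cases hx : x = 1
      · subst hx
        rw [hb1, map_sub, map_one, map_sum]
        simp only [hF]
        rw [← sum_dkVar k G, Fintype.sum_eq_add_sum_subtype_ne (dkVar k) 1,
          add_sub_cancel_right]
      · rw [hb2 ⟨x, hx⟩, hF]
  have hcard : Fintype.card {x : G // x ≠ 1} = Fintype.card G - 1 := by
    rw [Fintype.card_subtype_compl, Fintype.card_subtype_eq]
  exact ⟨e.trans (MvPolynomial.renameEquiv k (Fintype.equivFinOfCardEq hcard))⟩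

variable (k G) in
/-- The linear forms on `D_k`, parametrized by the functions on `G`. -/
def dkLinear : (G → k) →ₗ[k] Dk k G := Fintype.linearCombination k (dkVar k)

omit [Group G] in
theorem dkLinear_apply (F : G → k) : dkLinear k G F = ∑ x, F x • dkVar k x :=
  Fintype.linearCombination_apply _ _ _

omit [Group G] in
theorem dkLinear_one : dkLinear k G 1 = 1 := by
  simp only [dkLinear_apply, Pi.one_apply, one_smul, sum_dkVar]

omit [Group G] in
theorem dkLinear_single [DecidableEq G] (x : G) : dkLinear k G (Pi.single x 1) = dkVar k x := by
  rw [dkLinear, Fintype.linearCombination_apply_single, one_smul]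

variable (k G) in
/-- The left regular representation on the functions on `G`. -/
def regularFunctions : G →* ((G → k) →ₗ[k] (G → k)) where
  toFun g := LinearMap.funLeft k k fun x => g⁻¹ * x
  map_one' := by
    ext
    simp [LinearMap.funLeft]
  map_mul' g h := by
    refine LinearMap.ext fun F => funext fun x => ?_
    simp [LinearMap.funLeft_apply, mul_assoc]

omit [Fintype G] in
theorem regularFunctions_apply (g : G) (F : G → k) (x : G) :
    regularFunctions k G g F x = F (g⁻¹ * x) := rfl

theorem DkAction_dkLinear (g : G) (F : G → k) :
    DkAction k G g (dkLinear k G F) = dkLinear k G (regularFunctions k G g F) := by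
  simp only [dkLinear_apply, map_sum, map_smul, DkAction_dkVar]
  refine Fintype.sum_equiv (Equiv.mulLeft g) _ _ fun x => ?_
  simp [regularFunctions_apply]

end DkBasics

/-! ### Triangularity of D_k -/

section DkTriangular

variable {p : ℕ} [Fact p.Prime] {k G A : Type*} [Field k] [CharP k p] [Group G] [Fintype G]

/-- `D_k` is a triangular extension of a subalgebra generated by linear forms. -/
theorem exists_dk_triangular_extension (hG : IsPGroup p G) [CommRing A] [Algebra k A]
    [Algebra A (Dk k G)] [IsScalarTower k A (Dk k G)] [IsNoetherianRing A] (m : ℕ)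
    (W : Submodule k (G → k)) (hW : ∀ g, ∀ F ∈ W, regularFunctions k G g F ∈ W)
    (hWA : ∀ F ∈ W, dkLinear k G F ∈ Set.range (algebraMap A (Dk k G)))
    (hm : Module.finrank k W + m = Fintype.card G)
    (hequiv : Nonempty (Dk k G ≃+* MvPolynomial (Fin m) A)) :
    ∃ e : MvPolynomial (Fin m) A ≃ₐ[A] Dk k G, ∀ g i,
      DkAction k G g (e (MvPolynomial.X i)) - e (MvPolynomial.X i) ∈
        Algebra.adjoin A ((fun j => e (MvPolynomial.X j)) '' {j | j < i}) := by
  classical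
  obtain ⟨v, hv, hvtop⟩ := exists_triangular_complement hG (regularFunctions k G) m W hW
    (by rw [hm, Module.finrank_fintype_fun_eq_card])
  let f : MvPolynomial (Fin m) A →ₐ[A] Dk k G := MvPolynomial.aeval fun i => dkLinear k G (v i)
  have hf : ∀ i, f (MvPolynomial.X i) = dkLinear k G (v i) := fun i => MvPolynomial.aeval_X _ _
  have hmem : ∀ (S : Subalgebra A (Dk k G)) (s : Set (Fin m)),
      (∀ i ∈ s, dkLinear k G (v i) ∈ S) →
      ∀ F ∈ W ⊔ Submodule.span k (v '' s), dkLinear k G F ∈ S := by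
    intro S s hs
    change W ⊔ Submodule.span k (v '' s) ≤
      (Subalgebra.toSubmodule (S.restrictScalars k)).comap (dkLinear k G)
    refine sup_le (fun F hF => ?_) ?_
    · obtain ⟨a, ha⟩ := hWA F hF
      rw [Submodule.mem_comap, ← ha]
      exact S.algebraMap_mem a
    · rw [Submodule.span_le]
      rintro _ ⟨i, hi, rfl⟩
      exact hs i hi
  have hsurj : Function.Surjective f := by
    have h1 : ∀ F, dkLinear k G F ∈ f.range := by
      intro F
      refine hmem f.range Set.univ (fun i _ => ⟨_, hf i⟩) F ?_
      rw [Set.image_univ, hvtop]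
      trivial
    have h2 : Algebra.adjoin k (Set.range (dkVar k : G → Dk k G)) ≤ f.range.restrictScalars k := by
      refine Algebra.adjoin_le ?_
      rintro _ ⟨x, rfl⟩
      rw [← dkLinear_single]
      exact h1 _
    rw [adjoin_range_dkVar] at h2
    exact fun P => h2 (show P ∈ ⊤ from trivial)
  obtain ⟨e₀⟩ := hequiv
  -- An isomorphism of rings unrelated to f is enough here, by the Hopfian property.
  have hinj : Function.Injective f :=
    injective_of_surjective_of_ringEquiv (f : MvPolynomial (Fin m) A →+* Dk k G) hsurj e₀
  refine ⟨AlgEquiv.ofBijective f ⟨hinj, hsurj⟩, fun g i => ?_⟩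
  change DkAction k G g (f (MvPolynomial.X i)) - f (MvPolynomial.X i) ∈
    Algebra.adjoin A ((fun j => f (MvPolynomial.X j)) '' {j | j < i})
  simp only [hf]
  rw [DkAction_dkLinear, ← map_sub]
  exact hmem (Algebra.adjoin A ((fun j => dkLinear k G (v j)) '' {j | j < i})) {j | j < i}
    (fun j hj => Algebra.subset_adjoin ⟨j, hj, rfl⟩) _ (hv g i)

/-- The constant function 1 gives the scalar 1 of D_k, so the flag starts above the line of
constants and one variable is lost. -/
theorem isTriangularPolynomial_DkAction (hG : IsPGroup p G) :
    IsTriangularPolynomial (Fintype.card G - 1) (DkAction k G) := by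
  obtain ⟨e₀⟩ := nonempty_dk_equiv k G
  have h1 : (1 : G → k) ≠ 0 := one_ne_zero
  have he : Nonempty (Dk k G ≃+* MvPolynomial (Fin (Fintype.card G - 1)) k) := ⟨e₀.toRingEquiv⟩
  refine exists_dk_triangular_extension (A := k) hG _ (Submodule.span k {1}) (fun g F hF => ?_)
    (fun F hF => ?_) ?_ he
  · obtain ⟨a, rfl⟩ := Submodule.mem_span_singleton.1 hF
    exact hF
  · obtain ⟨a, rfl⟩ := Submodule.mem_span_singleton.1 hF
    refine ⟨a, ?_⟩
    rw [map_smul, dkLinear_one, Algebra.algebraMap_eq_smul_one]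
  · rw [finrank_span_singleton h1]
    have := Fintype.card_pos (α := G)
    omega

end DkTriangular

/-! ### The invariants of D_k: passage from G/H to G -/

section DkInvariants

open Polynomial

variable {p : ℕ} [Fact p.Prime] {k G : Type*} [Field k] [CharP k p] [Group G] [Fintype G]
  {H : Subgroup G} [H.Normal] [Fintype (G ⧸ H)]

variable (k H) in
/-- Pulling back functions along the quotient map. -/
abbrev pullbackFunctions : ((G ⧸ H) → k) →ₗ[k] (G → k) :=
  LinearMap.funLeft k k QuotientGroup.mk

variable (k H) in
/-- The inclusion of `D_k(G ⧸ H)` into `D_k(G)`. -/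
def dkInflation : Dk k (G ⧸ H) →ₐ[k] Dk k G :=
  open scoped Classical in
  dkLift (fun q => dkLinear k G (pullbackFunctions k H (Pi.single q 1))) (by
    rw [← map_sum, ← map_sum, ← dkLinear_one]
    congr 1
    ext x
    simp [LinearMap.funLeft_apply, Finset.sum_apply, Pi.single_apply])

-- Inflation sends X_q to the sum of the X_x over x in the coset q, which is the pullback of the
-- indicator function of q.
omit [Fact p.Prime] [CharP k p] [H.Normal] in
theorem dkInflation_dkLinear (a : (G ⧸ H) → k) :
    dkInflation k H (dkLinear k (G ⧸ H) a) = dkLinear k G (pullbackFunctions k H a) := by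
  classical
  have : (dkInflation k H).toLinearMap ∘ₗ dkLinear k (G ⧸ H) =
      dkLinear k G ∘ₗ pullbackFunctions k H := by
    refine LinearMap.pi_ext' fun q => LinearMap.ext_ring ?_
    change dkInflation k H (dkLinear k (G ⧸ H) (Pi.single q 1)) =
      dkLinear k G (pullbackFunctions k H (Pi.single q 1))
    rw [dkLinear_single, dkInflation, dkLift_dkVar]
  exact LinearMap.congr_fun this a

omit [Fact p.Prime] [CharP k p] [Fintype G] [Fintype (G ⧸ H)] in
theorem regularFunctions_pullbackFunctions (g : G) (a : (G ⧸ H) → k) :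
    regularFunctions k G g (pullbackFunctions k H a) =
      pullbackFunctions k H (regularFunctions k (G ⧸ H) (QuotientGroup.mk g) a) := by
  ext x
  simp [regularFunctions_apply, LinearMap.funLeft_apply]

omit [Fact p.Prime] [CharP k p] in
theorem DkAction_dkInflation (g : G) (P : Dk k (G ⧸ H)) :
    DkAction k G g (dkInflation k H P) =
      dkInflation k H (DkAction k (G ⧸ H) (QuotientGroup.mk g) P) := by
  classical
  have : (DkAction k G g : Dk k G →ₐ[k] Dk k G).comp (dkInflation k H) =
      (dkInflation k H).comp
        (DkAction k (G ⧸ H) (QuotientGroup.mk g) : Dk k (G ⧸ H) →ₐ[k] Dk k (G ⧸ H)) := by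
    refine dk_algHom_ext fun q => ?_
    change DkAction k G g (dkInflation k H (dkVar k q)) =
      dkInflation k H (DkAction k (G ⧸ H) (QuotientGroup.mk g) (dkVar k q))
    rw [← dkLinear_single, DkAction_dkLinear, dkInflation_dkLinear, dkInflation_dkLinear,
      DkAction_dkLinear, regularFunctions_pullbackFunctions]
  exact DFunLike.congr_fun this P

/-- The map from the central extension of `D_k(G ⧸ H)` to `D_k(G)`. -/
def dkExtensionHom (e : H ≃* Multiplicative (ZMod p)) : (Dk k (G ⧸ H))[X] →+* Dk k G :=
  eval₂RingHom (dkInflation k H : Dk k (G ⧸ H) →+* Dk k G) (dkLinear k G (cosetCoord k e))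

omit [H.Normal] in
theorem dkExtensionHom_C (e : H ≃* Multiplicative (ZMod p)) (P : Dk k (G ⧸ H)) :
    dkExtensionHom e (C P) = dkInflation k H P := eval₂_C _ _

omit [H.Normal] in
theorem dkExtensionHom_X (e : H ≃* Multiplicative (ZMod p)) :
    dkExtensionHom e (X : (Dk k (G ⧸ H))[X]) = dkLinear k G (cosetCoord k e) := eval₂_X _ _

omit [Fintype G] [H.Normal] [Fintype (G ⧸ H)] in
theorem regularFunctions_cosetCoord (e : H ≃* Multiplicative (ZMod p)) (g : G) :
    regularFunctions k G g (cosetCoord k e) = cosetCoord k e + pullbackFunctions k H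
      fun q => cosetCoord k e (g⁻¹ * q.out) - cosetCoord k e q.out := by
  ext x
  rw [regularFunctions_apply, Pi.add_apply, LinearMap.funLeft_apply,
    cosetCoord_sub_eq e g⁻¹ (x := (QuotientGroup.mk x : G ⧸ H).out) (x' := x)
      (QuotientGroup.out_eq' _), add_sub_cancel]

/-- For the point `dkVar k 1` the extension cocycle is, as a linear form, the defect of `cosetCoord`
under translation. So X may be sent to the form of `cosetCoord`. -/
theorem DkAction_dkExtensionHom (e : H ≃* Multiplicative (ZMod p)) (g : G)
    (P : (Dk k (G ⧸ H))[X]) :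
    DkAction k G g (dkExtensionHom e P) =
      dkExtensionHom e (extensionAction e (DkAction k (G ⧸ H)) (dkVar k 1) g P) := by
  have : (DkAction k G g : Dk k G →+* Dk k G).comp (dkExtensionHom e) =
      (dkExtensionHom e).comp
        (extensionAction e (DkAction k (G ⧸ H)) (dkVar k 1) g : _ →+* (Dk k (G ⧸ H))[X]) := by
    refine Polynomial.ringHom_ext (fun P => ?_) ?_
    · change DkAction k G g (dkExtensionHom e (C P)) =
        dkExtensionHom e (extensionAction e (DkAction k (G ⧸ H)) (dkVar k 1) g (C P))
      rw [extensionAction_C, dkExtensionHom_C, dkExtensionHom_C, DkAction_dkInflation]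
    · change DkAction k G g (dkExtensionHom e X) =
        dkExtensionHom e (extensionAction e (DkAction k (G ⧸ H)) (dkVar k 1) g X)
      rw [extensionAction_X, map_add, dkExtensionHom_C, dkExtensionHom_X, DkAction_dkLinear,
        regularFunctions_cosetCoord, map_add, ← dkInflation_dkLinear,
        dkLinear_apply (G := G ⧸ H),
        extensionCocycle]
      simp only [DkAction_dkVar, mul_one]
  exact RingHom.congr_fun this P

/-- The invariant ring of `D_k(G)` is a polynomial ring if that of `D_k(G ⧸ H)` is one, for a
central subgroup `H` of order `p`. -/
theorem isPolynomialRing_invariants_DkAction_of_quotient {n : ℕ}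
    (e : H ≃* Multiplicative (ZMod p)) (hH : ∀ y ∈ H, ∀ x, y * x = x * y)
    (hG : Fintype.card G = p ^ (n + 1)) (hq : Fintype.card (G ⧸ H) = p ^ n)
    (hpoly : IsPolynomialRing k (invariants (DkAction k (G ⧸ H)))) :
    IsPolynomialRing k (invariants (DkAction k G)) := by
  have hp : 1 < p := (Fact.out : p.Prime).one_lt
  have hpn : p ^ n + 1 ≤ p ^ (n + 1) := Nat.pow_lt_pow_right hp n.lt_succ_self
  have hpn1 : 1 ≤ p ^ n := Nat.one_le_pow _ _ hp.le
  let _ : Algebra (Dk k (G ⧸ H))[X] (Dk k G) := (dkExtensionHom e).toAlgebra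
  have hmap : ∀ P : (Dk k (G ⧸ H))[X], algebraMap (Dk k (G ⧸ H))[X] (Dk k G) P =
      dkExtensionHom e P := fun P =>
    RingHom.congr_fun (RingHom.algebraMap_toAlgebra (dkExtensionHom e)) P
  have : IsScalarTower k (Dk k (G ⧸ H))[X] (Dk k G) := IsScalarTower.of_algebraMap_eq
      (R := k) (S := (Dk k (G ⧸ H))[X]) (A := Dk k G) fun r => by
    rw [hmap]
    exact ((dkExtensionHom_C e _).trans ((dkInflation k H).commutes r)).symm
  -- The range of L consists of functions whose linear forms already come from D_k(G/H)[X]. Its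
  -- dimension is p^n + 1.
  let L : (((G ⧸ H) → k) × k) →ₗ[k] (G → k) :=
    (pullbackFunctions k H).coprod (LinearMap.toSpanSingleton k _ (cosetCoord k e))
  have hL : ∀ a t, L (a, t) = pullbackFunctions k H a + t • cosetCoord k e := fun a t => rfl
  have hLinj : Function.Injective L := by
    rw [injective_iff_map_eq_zero]
    rintro ⟨a, t⟩ h
    have h1 : ∀ x : G, a (QuotientGroup.mk x) + t * cosetCoord k e x = 0 := fun x =>
      congrFun h x
    -- Moving by y inside a coset fixes the pulled-back part and changes the coordinate by 1, which
    -- isolates t.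
    let y : H := e.symm (Multiplicative.ofAdd 1)
    have hy : zmodValue k e y = 1 := by simp [zmodValue, y]
    have h2 := h1 1
    have h3 := h1 (1 * y)
    have h4 : (QuotientGroup.mk (1 * (y : G)) : G ⧸ H) = QuotientGroup.mk 1 := by simp
    rw [h4, cosetCoord_mul, hy] at h3
    have ht : t = 0 := by linear_combination h2 - h3
    refine Prod.ext (funext fun q => ?_) ht
    obtain ⟨x, rfl⟩ := QuotientGroup.mk_surjective q
    have h5 := h1 x
    rwa [ht, zero_mul, add_zero] at h5
  have hrank : Module.finrank k (LinearMap.range L) = p ^ n + 1 := by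
    rw [LinearMap.finrank_range_of_inj hLinj, Module.finrank_prod,
      Module.finrank_fintype_fun_eq_card, hq, Module.finrank_self]
  obtain ⟨e₁⟩ := nonempty_dk_equiv k G
  obtain ⟨e₂⟩ := nonempty_dk_equiv k (G ⧸ H)
  have e₃ : (Dk k (G ⧸ H))[X] ≃ₐ[k] MvPolynomial (Fin (Fintype.card (G ⧸ H) - 1 + 1)) k :=
    (polynomialVariablesEquiv e₂.symm).symm
  obtain ⟨e₄⟩ := nonempty_mvPolynomial_mvPolynomial_equiv (R := (Dk k (G ⧸ H))[X])
    e₃ (p ^ (n + 1) - (p ^ n + 1))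
  -- D_k(G/H)[X] has p^n variables, and a complement to the range of L supplies the rest. This count
  -- gives the abstract isomorphism needed for injectivity.
  have hdim : Fintype.card G - 1 =
      p ^ (n + 1) - (p ^ n + 1) + (Fintype.card (G ⧸ H) - 1 + 1) := by
    rw [hG, hq]
    omega
  have hα : ∀ g P, DkAction k G g (algebraMap _ _ P) = algebraMap (Dk k (G ⧸ H))[X] (Dk k G)
      (extensionAction e (DkAction k (G ⧸ H)) (dkVar k 1) g P) := fun g P => by
    rw [hmap, hmap, DkAction_dkExtensionHom]
  obtain ⟨E, hE⟩ := exists_dk_triangular_extension (A := (Dk k (G ⧸ H))[X])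
    (IsPGroup.of_card (Nat.card_eq_fintype_card.trans hG)) (p ^ (n + 1) - (p ^ n + 1))
    (LinearMap.range L)
    (by
      rintro g _ ⟨⟨a, t⟩, rfl⟩
      rw [hL, map_add, map_smul, regularFunctions_pullbackFunctions, regularFunctions_cosetCoord]
      refine ⟨(regularFunctions k (G ⧸ H) (QuotientGroup.mk g) a +
        t • fun q : G ⧸ H => cosetCoord k e (g⁻¹ * q.out) - cosetCoord k e q.out, t), ?_⟩
      rw [hL, map_add, map_smul, smul_add]
      abel)
    (by
      rintro _ ⟨⟨a, t⟩, rfl⟩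
      refine ⟨C (dkLinear k _ a) + t • X, ?_⟩
      have hs := map_smul (IsScalarTower.toAlgHom k (Dk k (G ⧸ H))[X] (Dk k G)) t X
      simp only [IsScalarTower.coe_toAlgHom'] at hs
      rw [hL, map_add, map_add, map_smul (dkLinear k G), hs, hmap, hmap, dkExtensionHom_C,
        dkExtensionHom_X, dkInflation_dkLinear])
    (by
      rw [hrank, hG]
      omega)
    ⟨(e₁.trans ((MvPolynomial.renameEquiv k (finCongr hdim)).trans e₄.symm)).toRingEquiv⟩
  obtain ⟨φ, hφ, -⟩ := exists_invariant_variables _ (DkAction k G) hα _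
    (trace_extensionAction e hH (DkAction k (G ⧸ H)) trace_dkVar_one) E hE
  obtain ⟨ψ, -⟩ := exists_invariants_equiv _ (DkAction k G) hα φ hφ
  have : IsDomain (Dk k (G ⧸ H)) := e₂.toMulEquiv.isDomain _
  obtain ⟨j⟩ := nonempty_invariants_extensionAction_equiv e hH (DkAction k (G ⧸ H))
    (trace_dkVar_one (k := k))
  obtain ⟨N, ⟨i⟩⟩ := hpoly
  obtain ⟨l⟩ := nonempty_mvPolynomial_mvPolynomial_equiv
    (j.symm.trans (polynomialVariablesEquiv i.symm).symm) (p ^ (n + 1) - (p ^ n + 1))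
  exact ⟨_, ⟨ψ.symm.trans l⟩⟩

end DkInvariants

/-! ### The invariants of D_k are polynomial -/

section DkInvariantsInduction

theorem isPolynomialRing_invariants_DkAction (p : ℕ) [Fact p.Prime] (k : Type u) [Field k]
    [CharP k p] (n : ℕ) : ∀ (G : Type v) [Group G] [Fintype G], Fintype.card G = p ^ n →
      IsPolynomialRing k (invariants (DkAction k G)) := by
  induction n with
  | zero =>
    intro G _ _ hG
    have : Subsingleton G := Fintype.card_le_one_iff_subsingleton.1 (by rw [hG, pow_zero])
    have h : invariants (DkAction k G) = ⊤ := by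
      refine eq_top_iff.2 fun x _ g => ?_
      rw [Subsingleton.elim g 1, action_one_apply]
    obtain ⟨e⟩ := nonempty_dk_equiv k G
    exact ⟨_, ⟨(Subalgebra.equivOfEq _ _ h).trans (Subalgebra.topEquiv.trans e)⟩⟩
  | succ n ih =>
    intro G _ _ hG
    obtain ⟨H, hH, ⟨e⟩, hcard⟩ := exists_central_subgroup hG
    have := normal_of_central hH
    have := Fintype.ofFinite (G ⧸ H)
    rw [Nat.card_eq_fintype_card] at hcard
    exact isPolynomialRing_invariants_DkAction_of_quotient e hH hG hcard (ih (G ⧸ H) hcard)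

end DkInvariantsInduction

/-! ### Transport along equivariant isomorphisms -/

section Transport

variable {k G A B : Type*} [CommRing k] [Group G] [CommRing A] [Algebra k A]
  [CommRing B] [Algebra k B]

theorem IsTs.of_equiv [Fintype G] {ρ : G →* (A ≃ₐ[k] A)} {σ : G →* (B ≃ₐ[k] B)} {e : A ≃ₐ[k] B}
    (he : IsEquivariant ρ σ (e : A →ₐ[k] B)) (h : IsTs ρ) : IsTs σ := by
  obtain ⟨c, hc⟩ := h.exists_point
  have := h.1
  refine ⟨Algebra.FiniteType.equiv this e, (isTraceSurjective_iff σ).2 ⟨e c, ?_⟩⟩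
  have h1 := he.map_trace c
  rw [hc, map_one] at h1
  exact h1.symm

theorem IsTriangularPolynomial.of_equiv {d : ℕ} {ρ : G →* (A ≃ₐ[k] A)} {σ : G →* (B ≃ₐ[k] B)}
    {e : A ≃ₐ[k] B} (he : IsEquivariant ρ σ (e : A →ₐ[k] B)) (h : IsTriangularPolynomial d ρ) :
    IsTriangularPolynomial d σ := by
  obtain ⟨e₀, he₀⟩ := h
  refine ⟨e₀.trans e, fun g i => ?_⟩
  have h1 : (Algebra.adjoin k ((fun j => e₀ (MvPolynomial.X j)) '' {j | j < i})) ≤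
      (Algebra.adjoin k ((fun j => (e₀.trans e) (MvPolynomial.X j)) '' {j | j < i})).comap
        (e : A →ₐ[k] B) := by
    refine Algebra.adjoin_le ?_
    rintro _ ⟨j, hj, rfl⟩
    exact Algebra.subset_adjoin ⟨j, hj, rfl⟩
  have h2 := h1 (he₀ g i)
  rw [Subalgebra.mem_comap, map_sub, he g] at h2
  exact h2

theorem IsTriangularPolynomial.isTs [Fintype G] {d : ℕ} {ρ : G →* (A ≃ₐ[k] A)}
    (h : IsTriangularPolynomial d ρ) {c : A} (hc : trace ρ c = 1) : IsTs ρ := by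
  obtain ⟨e, -⟩ := h
  exact ⟨Algebra.FiniteType.equiv inferInstance e, (isTraceSurjective_iff ρ).2 ⟨c, hc⟩⟩

end Transport

/-! ### Existence of U -/

section Retract

variable {p n : ℕ} [Fact p.Prime] {k : Type u} [Field k] [CharP k p] {G : Type v} [Group G]
  [Fintype G]

theorem exists_isU (hG : Fintype.card G = p ^ n) : ∃ U, IsU k G n U := by
  obtain ⟨A, _, _, α, c, hα, hc, hgen, ⟨i⟩⟩ := exists_basic_algebra p k n G hG
  obtain ⟨f, hf, hfc⟩ := exists_equivariant_of_point α hc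
  have hfs : Function.Surjective f := by
    rw [← AlgHom.range_eq_top, eq_top_iff, ← hgen]
    refine Algebra.adjoin_le ?_
    rintro _ ⟨g, rfl⟩
    exact ⟨_, hfc g⟩
  -- Lifting the identity of A along f gives an equivariant section s. Its range is U, and the
  -- kernel of f is the complementary ideal.
  obtain ⟨s, hs, hfs⟩ := hα.exists_lift trace_dkVar_one hf hfs
    (show IsEquivariant α α (AlgHom.id k A) from fun _ _ => rfl)
  have hfsa : ∀ a, f (s a) = a := fun a => DFunLike.congr_fun hfs a
  have hstable : ∀ g, ∀ u ∈ s.range, DkAction k G g u ∈ s.range := by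
    rintro g _ ⟨a, rfl⟩
    exact ⟨α g a, hs g a⟩
  let e : A ≃ₐ[k] s.range := AlgEquiv.ofInjective s (Function.LeftInverse.injective hfsa)
  have he : IsEquivariant α (restrictAction (DkAction k G) s.range hstable)
      (e : A →ₐ[k] s.range) := fun g a => Subtype.ext (hs g a)
  refine ⟨s.range, hstable, (hα.isTs hc).of_equiv he, hα.of_equiv he,
    ⟨RingHom.ker f, fun g P hP => ?_, ?_⟩, ?_⟩
  · rw [RingHom.mem_ker] at hP ⊢
    rw [hf, hP, map_zero]
  · refine IsCompl.of_eq (eq_bot_iff.2 ?_) (eq_top_iff.2 fun P _ => ?_)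
    · rintro _ ⟨⟨a, rfl⟩, hP⟩
      have h1 : f (s a) = 0 := hP
      rw [hfsa] at h1
      change s a = 0
      rw [h1, map_zero]
    · rw [← add_sub_cancel (s (f P)) P]
      refine add_mem (Submodule.mem_sup_left ⟨f P, rfl⟩) (Submodule.mem_sup_right ?_)
      change f (P - s (f P)) = 0
      rw [map_sub, hfsa, sub_self]
  · obtain ⟨j⟩ := he.symm.nonempty_invariants_equiv
    exact ⟨j.trans i⟩

end Retract

end GAlg

end

/-! ### The theorem -/

theorem theorem0p5 (p n : ℕ) [Fact p.Prime] (hn : n ≠ 0)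
    (k : Type u) [Field k] [CharP k p] (G : Type v) [Group G] [Fintype G]
    (hG : Fintype.card G = p ^ n) :
    (∀ (d : ℕ) (Γ : Type w) [CommRing Γ] [Algebra k Γ] (ρ : G →* (Γ ≃ₐ[k] Γ)),
      GAlg.IsTs ρ → GAlg.IsTriangularPolynomial d ρ →
        (GAlg.IsSProjective.{t} ρ ∧ GAlg.IsSGenerator.{t} ρ ∧ GAlg.IsGenerator.{t} ρ) ∧
        (∀ (A : Type t) [CommRing A] [Algebra k A] (α : G →* (A ≃ₐ[k] A)), GAlg.IsTs α →
          ∃ φ : MvPolynomial (Fin d) A ≃ₐ[A] A ⊗[k] Γ,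
            (∀ i, φ (MvPolynomial.X i) ∈ GAlg.invariants (GAlg.tensorAction α ρ)) ∧
            (∀ g q, φ (MvPolynomial.map (α g : A →+* A) q) =
              GAlg.tensorAction α ρ g (φ q)) ∧
            ∃ ψ : MvPolynomial (Fin d) (GAlg.invariants α) ≃ₐ[k]
                GAlg.invariants (GAlg.tensorAction α ρ),
              ∀ q, (ψ q : A ⊗[k] Γ) =
                φ (MvPolynomial.map (algebraMap (GAlg.invariants α) A) q)) ∧
        (∀ ℓ : ℕ, 1 ≤ ℓ →
          ∃ (N : ℕ) (e : (⨂[k] _ : Fin ℓ, Γ) ≃ₐ[k] Γ ⊗[k] MvPolynomial (Fin N) k),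
            GAlg.IsEquivariant (GAlg.tensorPowerAction ℓ ρ) (GAlg.tensorAction ρ 1)
              (e : (⨂[k] _ : Fin ℓ, Γ) →ₐ[k] Γ ⊗[k] MvPolynomial (Fin N) k)) ∧
        (∀ ℓ : ℕ, 1 ≤ ℓ →
          GAlg.IsStablyPolynomial k (GAlg.invariants (GAlg.tensorPowerAction ℓ ρ)))) ∧
    (GAlg.IsTs (GAlg.DkAction k G) ∧
      GAlg.IsTriangularPolynomial (Fintype.card G - 1) (GAlg.DkAction k G) ∧
      ∀ ℓ : ℕ, 1 ≤ ℓ → GAlg.IsPolynomialRing k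
        (GAlg.invariants (GAlg.tensorPowerAction ℓ (GAlg.DkAction k G)))) ∧
    (∃ U, GAlg.IsU k G n U) ∧
    (∀ U (hU : GAlg.IsU k G n U), ∀ ℓ : ℕ, 1 ≤ ℓ → GAlg.IsPolynomialRing k
      (GAlg.invariants (GAlg.tensorPowerAction ℓ
        (GAlg.restrictAction (GAlg.DkAction k G) U hU.stable)))) := by
  have hp : p.Prime := Fact.out
  have hpG : IsPGroup p G := IsPGroup.of_card (Nat.card_eq_fintype_card.trans hG)
  have hD := GAlg.isTriangularPolynomial_DkAction (k := k) hpG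
  have hDc : GAlg.trace (GAlg.DkAction k G) (GAlg.dkVar k 1) = 1 := GAlg.trace_dkVar_one
  have hDpoly := GAlg.isPolynomialRing_invariants_DkAction p k n G hG
  refine ⟨fun d Γ _ _ ρ hts hρ => ?_, ⟨GAlg.isTs_DkAction, hD, fun ℓ hℓ =>
    hD.isPolynomialRing_invariants_tensorPower hDc hDpoly hℓ⟩, GAlg.exists_isU hG,
    fun U hU ℓ hℓ => ?_⟩
  · have := hts.isNoetherianRing
    obtain ⟨c, hc⟩ := hts.exists_point
    -- For stable polynomiality D_k serves as the comparison algebra with polynomial invariants.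
    refine ⟨⟨hρ.isSProjective, hρ.isSGenerator hp hn hG hts, hρ.isGenerator hp hn hG hts⟩,
      fun A _ _ α hα => ?_, fun ℓ hℓ => hρ.exists_tensorPower_equiv hc hℓ,
      fun ℓ hℓ => hρ.isStablyPolynomial_invariants_tensorPower hc hD hDc hDpoly hℓ⟩
    have := hα.isNoetherianRing
    obtain ⟨a, ha⟩ := hα.exists_point
    obtain ⟨e, he⟩ := hρ
    obtain ⟨φ, hφ, -⟩ := GAlg.exists_tensor_invariant_variables α ρ ha e he
    have hαρ := GAlg.tensorAction_algebraMap α ρ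
    exact ⟨φ, hφ, GAlg.equivariant_of_invariant_variables α _ hαρ φ hφ,
      GAlg.exists_invariants_equiv α _ hαρ φ hφ⟩
  · have := hU.ts.isNoetherianRing
    obtain ⟨c, hc⟩ := hU.ts.exists_point
    exact hU.triangular.isPolynomialRing_invariants_tensorPower hc ⟨n, hU.invariants⟩ hℓ
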